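/- Let there be $n$ agents and a set $[m]$ of $m$ items. Each agent $i$ has a valuation $v_i:2^{[m]}\to\mathbb R_{\ge 0}$ that is monotone ($S\subseteq T\Rightarrow v_i(S)\le v_i(T)$) and subadditive ($v_i(S\cup T)\le v_i(S)+v_i(T)$ for all $S,T$). An allocation is a vector $X=(X_1,\dots,X_n)$ of pairwise disjoint subsets of $[m]$, possibly leaving items unallocated; it is complete if $\bigcup_i X_i=[m]$. Write $\mathrm{NW}(X)=\prod_i v_i(X_i)^{1/n}$. An allocation $X$ is $\alpha$-EFX if $v_i(X_i)\ge\alpha\, v_i(X_j\setminus\{g\})$ for all $i,j$ and $g\in X_j$; it is $\beta$-MNW if $\mathrm{NW}(X)\ge\beta\,\mathrm{NW}(Y)$ for every allocation $Y$. Let $0\le\alpha\le 1/2$. (a) There is a (partial) allocation that is $\alpha$-EFX and $\frac1{\alpha+1}$-MNW. (b) Let $X$ be any complete allocation. Every run of the algorithm below on input $X$ (with arbitrary choices wherever it says "any") is never stuck, stops after at most $(n+1)(m+1)^3$ iterations, and returns an allocation $M$ that is $\alpha$-EFX and satisfies $\mathrm{NW}(M)\ge\frac1{\alpha+1}\mathrm{NW}(X)$.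 Algorithm. It maintains sets $X_j$ (initially the input), white bundles $Z_j$ (initially $Z_j=X_j$), red bundles $X_j\setminus Z_j$, and for each agent $i$ a partner $M_i$, which is $\bot$ (unmatched, the initial value), a white bundle $Z_j$ (identified by its index $j$, so that distinct empty bundles are different partners), or a fixed set of items (a blue bundle). "Unmatch $Z_j$" sets $M_u\gets\bot$ for the agent $u$ matched to $Z_j$, if any; "shrink $X_j$" sets $X_j\gets Z_j$. While some agent is unmatched: take any unmatched $i$; let $\mathcal B$ consist of all $Z_j\setminus\{g\}$ with $g\in Z_j$, all $X_j\setminus Z_j$, and all $M_j\setminus\{g\}$ with $j$ matched and $g\in M_j$; let $J$ be any element of $\mathcal B$ maximizing $v_i(J)$. 1. If $v_i(Z_i)\ge\alpha v_i(J')$ for all $J'\in\mathcal B$: unmatch $Z_i$ and match $i$ to $Z_i$. 2. Else if $J=Z_j\setminus\{g\}$ for some $j$ and $g\in Z_j$: unmatch $Z_j$, match $i$ to $J$, let $R=X_j\setminus J$, and for $S\subseteq R$ let $\mathcal K_S=\{k: M_k=Z_k,\ v_k(Z_k)<\alpha v_k(S)\}$. The tests below use the values before any of the following changes; where $Z_j$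 becomes $J$, agent $i$ is then matched to the white bundle $Z_j$. - (2.1) If $v_j(\{g\})\ge\frac{\alpha}{\alpha+1}v_j(X_j)$: $Z_j\gets\{g\}$; shrink $X_j$. - Else if $\mathcal K_S=\emptyset$ for all $S\subseteq R$: (2.2) if $v_j(R)<\frac{\alpha}{\alpha+1}v_j(X_j)$, then $Z_j\gets J$; (2.3) otherwise $Z_j\gets R$ and shrink $X_j$. - Else take any $S\subseteq R$ of minimal size with $\mathcal K_S\ne\emptyset$ and any $k\in\mathcal K_S$. (2.4) If $v_j(J)\ge\alpha v_j(X_j)$: $Z_j\gets J$; shrink $X_k$ and $X_j$; match $k$ to $S$. (2.5) Else if $v_j(S)\ge\frac{\alpha}{\alpha+1}v_j(X_j)$: $Z_j\gets S$; shrink $X_j$. (2.6) Else: $Z_j\gets R\setminus S$; shrink $X_k$ and $X_j$; match $k$ to $S$. 3. Else if $J=X_j\setminus Z_j$ for some $j$: shrink $X_j$ and match $i$ to $J$. 4. Else $J=M_j\setminus\{g\}$ for some $j$ and $g\in M_j$: set $M_j\gets\bot$ and match $i$ to $J$. When all agents are matched, return $(M_1,\dots,M_n)$. -/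

import Mathlib

namespace FairDivision

/-- A profile of valuations: `v i S` is the value of agent `i` for the bundle `S` of items. -/
abbrev Valuations (n m : ℕ) := Fin n → Finset (Fin m) → ℝ

/-- An assignment of a bundle of items to every agent. -/
abbrev Bundles (n m : ℕ) := Fin n → Finset (Fin m)

variable {n m : ℕ}

/-- Values are nonnegative reals, and more items are never worth less. -/
def IsMonotone (v : Valuations n m) : Prop :=
  (∀ i S, 0 ≤ v i S) ∧ ∀ i S T, S ⊆ T → v i S ≤ v i T

def IsSubadditive (v : Valuations n m) : Prop :=
  ∀ i S T, v i (S ∪ T) ≤ v i S + v i T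

/-- A (possibly partial) allocation: bundles of distinct agents are disjoint. -/
def IsAllocation (X : Bundles n m) : Prop :=
  ∀ i j, i ≠ j → Disjoint (X i) (X j)

/-- Every item is allocated. -/
def IsComplete (X : Bundles n m) : Prop :=
  ∀ g, ∃ i, g ∈ X i

/-- The allocation `X` is `α`-EFX. -/
def IsEFX (α : ℝ) (v : Valuations n m) (X : Bundles n m) : Prop :=
  ∀ i j, ∀ g ∈ X j, α * v i ((X j).erase g) ≤ v i (X i)

/-- The Nash welfare, the geometric mean of the agents' values. -/
noncomputable def nashWelfare (v : Valuations n m) (X : Bundles n m) : ℝ :=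
  ∏ i, v i (X i) ^ (1 / (n : ℝ))

/-- `Z` is `β`-MNW: its Nash welfare is at least `β` times the maximum Nash welfare of an
allocation. -/
def IsMNW (β : ℝ) (v : Valuations n m) (Z : Bundles n m) : Prop :=
  ∀ Y : Bundles n m, IsAllocation Y → β * nashWelfare v Y ≤ nashWelfare v Z

/-! ### The algorithm -/

/-- What an agent is matched to: nothing (`⊥`), the current white bundle `Z j`, or a blue bundle,
that is, a fixed set `B` of items that is not (any more) one of the bundles `Z j`. -/
inductive Partner (n m : ℕ) where
  | unmatched : Partner n m
  | white (j : Fin n) : Partner n m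
  | blue (B : Finset (Fin m)) : Partner n m
  deriving DecidableEq

/-- The global variables of the algorithm. The sets `Z j` are the white bundles and the sets
`X j \ Z j` are the red bundles. -/
structure State (n m : ℕ) where
  X : Bundles n m
  Z : Bundles n m
  M : Fin n → Partner n m

namespace State

/-- The bundle `M_i`, with `none` for `⊥`. -/
def bundle (s : State n m) (i : Fin n) : Option (Finset (Fin m)) :=
  match s.M i with
  | .unmatched => none
  | .white j => some (s.Z j)
  | .blue B => some B

/-- The initial state on input `X`. -/
def init (X : Bundles n m) : State n m :=
  { X := X, Z := X, M := fun _ => .unmatched }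

/-- The loop has ended: all agents are matched. -/
def IsFinal (s : State n m) : Prop := ∀ i, s.M i ≠ .unmatched

/-- The assignment `(M_1, …, M_n)` that is returned at the end. -/
def output (s : State n m) : Bundles n m := fun i => (s.bundle i).getD ∅

/-- Match agent `i` to `p`. -/
def matchTo (s : State n m) (i : Fin n) (p : Partner n m) : State n m :=
  { s with M := Function.update s.M i p }

/-- Unmatch the agent `i`. -/
def unmatchAgent (s : State n m) (i : Fin n) : State n m := s.matchTo i .unmatched

/-- Unmatch the white bundle `Z j`: whoever is matched to it becomes unmatched. -/
def unmatchWhite (s : State n m) (j : Fin n) : State n m :=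
  { s with M := fun u => if s.M u = .white j then .unmatched else s.M u }

/-- Change `Z j` to `J`. -/
def change (s : State n m) (j : Fin n) (J : Finset (Fin m)) : State n m :=
  { s with Z := Function.update s.Z j J }

/-- Shrink `X j`, that is, set it to the current `Z j`. -/
def shrink (s : State n m) (j : Fin n) : State n m :=
  { s with X := Function.update s.X j (s.Z j) }

/-- `J` is a white bundle minus an item. -/
def WhiteAvail (s : State n m) (J : Finset (Fin m)) : Prop :=
  ∃ j, ∃ g ∈ s.Z j, J = (s.Z j).erase g

/-- `J` is a red bundle. -/
def RedAvail (s : State n m) (J : Finset (Fin m)) : Prop :=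
  ∃ j, J = s.X j \ s.Z j

/-- `J` is a matched bundle minus an item. -/
def MatchedAvail (s : State n m) (J : Finset (Fin m)) : Prop :=
  ∃ j, ∃ B, s.bundle j = some B ∧ ∃ g ∈ B, J = B.erase g

/-- The set `ℬ` of available bundles. -/
def Avail (s : State n m) (J : Finset (Fin m)) : Prop :=
  s.WhiteAvail J ∨ s.RedAvail J ∨ s.MatchedAvail J

/-- `J` is an available bundle of maximum value to `i`. -/
def IsFavorite (v : Valuations n m) (s : State n m) (i : Fin n) (J : Finset (Fin m)) : Prop :=
  s.Avail J ∧ ∀ J', s.Avail J' → v i J' ≤ v i J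

/-- `Z i` is good enough for `i`. -/
def SelfGood (α : ℝ) (v : Valuations n m) (s : State n m) (i : Fin n) : Prop :=
  ∀ J, s.Avail J → α * v i J ≤ v i (s.Z i)

/-- `𝒦_S`: the agents `k` matched to their own `Z k` who value `Z k` less than `α` times `S`. -/
def envious (α : ℝ) (v : Valuations n m) (s : State n m) (S : Finset (Fin m)) : Set (Fin n) :=
  {k | s.M k = .white k ∧ v k (s.Z k) < α * v k S}

/-- `S` is a subset of `R` of minimal size such that `𝒦_S` is nonempty. -/
def IsMinEnvied (α : ℝ) (v : Valuations n m) (s : State n m) (R S : Finset (Fin m)) : Prop :=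
  S ⊆ R ∧ (s.envious α v S).Nonempty ∧
    ∀ S', S' ⊆ R → (s.envious α v S').Nonempty → S.card ≤ S'.card

end State

open State

/-- The part of procedure SPLIT after its first two lines (unmatch `Z j`, match `i` to `J`), as a
relation between the state `s` before and the state after. Here `g ∈ Z j` and `J = Z j - g`, and
`i` is recorded in `s` as matched to the set `J`. In the two cases where `Z j` is changed to `J`,
`i` becomes matched to the new white bundle `Z j = J`. -/
inductive Split (α : ℝ) (v : Valuations n m) (i j : Fin n) (g : Fin m) (J : Finset (Fin m))
    (s : State n m) : State n m → Prop
  -- `{g}` is good enough for `j`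
  | case1 (hg : (α / (α + 1)) * v j (s.X j) ≤ v j {g}) :
      Split α v i j g J s ((s.change j {g}).shrink j)
  -- `J` is good enough for `j`
  | case2 (hg : v j {g} < (α / (α + 1)) * v j (s.X j))
      (hK : ∀ S, S ⊆ s.X j \ J → s.envious α v S = ∅)
      (hR : v j (s.X j \ J) < (α / (α + 1)) * v j (s.X j)) :
      Split α v i j g J s ((s.change j J).matchTo i (.white j))
  -- `R = X j \ J` is good enough for `j`
  | case3 (hg : v j {g} < (α / (α + 1)) * v j (s.X j))
      (hK : ∀ S, S ⊆ s.X j \ J → s.envious α v S = ∅)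
      (hR : (α / (α + 1)) * v j (s.X j) ≤ v j (s.X j \ J)) :
      Split α v i j g J s ((s.change j (s.X j \ J)).shrink j)
  -- `J` is good enough for `j`
  | case4 (S : Finset (Fin m)) (k : Fin n)
      (hg : v j {g} < (α / (α + 1)) * v j (s.X j))
      (hS : s.IsMinEnvied α v (s.X j \ J) S) (hk : k ∈ s.envious α v S)
      (hJ : α * v j (s.X j) ≤ v j J) :
      Split α v i j g J s
        (((((s.change j J).matchTo i (.white j)).shrink k).shrink j).matchTo k (.blue S))
  -- `S` is good enough for `j`
  | case5 (S : Finset (Fin m)) (k : Fin n)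
      (hg : v j {g} < (α / (α + 1)) * v j (s.X j))
      (hS : s.IsMinEnvied α v (s.X j \ J) S) (hk : k ∈ s.envious α v S)
      (hJ : v j J < α * v j (s.X j))
      (hjS : (α / (α + 1)) * v j (s.X j) ≤ v j S) :
      Split α v i j g J s ((s.change j S).shrink j)
  -- `R \ S` is good enough for `j`
  | case6 (S : Finset (Fin m)) (k : Fin n)
      (hg : v j {g} < (α / (α + 1)) * v j (s.X j))
      (hS : s.IsMinEnvied α v (s.X j \ J) S) (hk : k ∈ s.envious α v S)
      (hJ : v j J < α * v j (s.X j))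
      (hjS : v j S < (α / (α + 1)) * v j (s.X j)) :
      Split α v i j g J s
        ((((s.change j ((s.X j \ J) \ S)).shrink k).shrink j).matchTo k (.blue S))

/-- One iteration of the while loop. All choices (of the unmatched agent `i`, of the favorite
bundle `J`, of `S` and `k`) are arbitrary, so this is a relation. -/
inductive Step (α : ℝ) (v : Valuations n m) (s : State n m) : State n m → Prop
  -- `Z i` is good enough for `i`
  | self (i : Fin n) (hi : s.M i = .unmatched) (hgood : s.SelfGood α v i) :
      Step α v s ((s.unmatchWhite i).matchTo i (.white i))
  -- `J` is white
  | white (i : Fin n) (J : Finset (Fin m)) (j : Fin n) (g : Fin m) (s' : State n m)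
      (hi : s.M i = .unmatched) (hJ : s.IsFavorite v i J) (hgood : ¬ s.SelfGood α v i)
      (hg : g ∈ s.Z j) (hJg : J = (s.Z j).erase g)
      (hsplit : Split α v i j g J ((s.unmatchWhite j).matchTo i (.blue J)) s') :
      Step α v s s'
  -- `J` is red
  | red (i : Fin n) (J : Finset (Fin m)) (j : Fin n)
      (hi : s.M i = .unmatched) (hJ : s.IsFavorite v i J) (hgood : ¬ s.SelfGood α v i)
      (hwhite : ¬ s.WhiteAvail J) (hJj : J = s.X j \ s.Z j) :
      Step α v s ((s.shrink j).matchTo i (.blue J))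
  -- `J` is blue
  | blue (i : Fin n) (J : Finset (Fin m)) (j : Fin n) (B : Finset (Fin m)) (g : Fin m)
      (hi : s.M i = .unmatched) (hJ : s.IsFavorite v i J) (hgood : ¬ s.SelfGood α v i)
      (hwhite : ¬ s.WhiteAvail J) (hred : ¬ s.RedAvail J)
      (hB : s.bundle j = some B) (hg : g ∈ B) (hJg : J = B.erase g) :
      Step α v s ((s.unmatchAgent j).matchTo i (.blue J))

/-- `Reaches α v X T s`: on input `X`, the algorithm can be in the state `s` after exactly `T`
iterations. -/
inductive Reaches (α : ℝ) (v : Valuations n m) (X : Bundles n m) : ℕ → State n m → Prop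
  | zero : Reaches α v X 0 (State.init X)
  | succ {T : ℕ} {s s' : State n m} (h : Reaches α v X T s) (hs : Step α v s s') :
      Reaches α v X (T + 1) s'

/-- Some run of the algorithm on input `X` returns `M`. -/
def Returns (α : ℝ) (v : Valuations n m) (X M : Bundles n m) : Prop :=
  ∃ T s, Reaches α v X T s ∧ s.IsFinal ∧ s.output = M

end FairDivision

/-! The proof follows an invariant `Inv` through every run, with three parts: the geometry of the
bundles (`Layout`), approximate envy-freeness of the matched agents (`Tolerant`), and welfare
accounting (`Credit`).

Envy: an agent taking a favorite bundle values every available bundle at most as much. Since `X j`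
minus an item of `Z j` is the union of a red bundle and a white bundle minus an item, subadditivity
and `α ≤ 1 / 2` make the agent tolerate that larger set as well (`robust_of_forall_avail`). The
bundles later cut out of `X j` by SPLIT miss an item of `Z j`, so they cannot upset such agents.
Only agents holding their own white bundle can object; the sets `𝒦_S` and the minimality of `S` deal
with them.

Welfare: each agent carries a credit `y j`, initially its value for the input bundle, and each new
blue bundle allows the product of the credits to drop by a factor `α / (α + 1)`. An agent holding
its own white bundle has credit at most `α + 1` times its value. An agent that rejected `Z j` for
`B` has credit at most `(α + 1) * α` times its value for `B`, and at most `α` times it once `Z j` is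
matched to nobody. When all agents are matched there are at least as many free white bundles as blue
bundles, so the factors `α` gained from free white bundles pay for those lost to blue ones. What
remains is `(α + 1) ^ n`, that is, `α + 1` after taking `n`-th roots (`Credit.le_prod_output`).

Termination: each iteration decreases a lexicographic potential (`Progress`) with fewer than `(n +
1) * (m + 1) ^ 3` possible values. The existence statement comes from running the algorithm on an
allocation of maximum Nash welfare. -/

namespace FairDivision

variable {n m : ℕ}

namespace State

/-! ### Available bundles and the loop invariant -/

/-- Agent `i` is matched to the set `B` of items. -/
def Holds (s : State n m) (i : Fin n) (B : Finset (Fin m)) : Prop :=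
  s.M i = .blue B ∨ ∃ j, s.M i = .white j ∧ s.Z j = B

theorem bundle_eq_some_iff (s : State n m) (i : Fin n) (B : Finset (Fin m)) :
    s.bundle i = some B ↔ s.Holds i B := by
  unfold bundle Holds
  cases h : s.M i <;> simp

/-- A matched white bundle minus an item is already listed among the white ones, so only blue
bundles matter in the third alternative. -/
theorem avail_iff (s : State n m) (J : Finset (Fin m)) :
    s.Avail J ↔ (∃ j, ∃ g ∈ s.Z j, J = (s.Z j).erase g) ∨ (∃ j, J = s.X j \ s.Z j) ∨
      ∃ u C, s.M u = .blue C ∧ ∃ g ∈ C, J = C.erase g := by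
  unfold Avail WhiteAvail RedAvail MatchedAvail
  constructor
  · rintro (h | h | ⟨u, C, hC, g, hg, rfl⟩)
    · exact .inl h
    · exact .inr (.inl h)
    · rw [bundle_eq_some_iff] at hC
      rcases hC with hC | ⟨j, -, rfl⟩
      · exact .inr (.inr ⟨u, C, hC, g, hg, rfl⟩)
      · exact .inl ⟨j, g, hg, rfl⟩
  · rintro (h | h | ⟨u, C, hC, h⟩)
    · exact .inl h
    · exact .inr (.inl h)
    · exact .inr (.inr ⟨u, C, (s.bundle_eq_some_iff u C).2 (.inl hC), h⟩)

/-- The number of agents matched to blue bundles. -/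
def blueCount (s : State n m) : ℕ :=
  (Finset.univ.filter fun i => ∃ B, s.M i = .blue B).card

/-- The sets `X j` and the blue bundles are disjoint, `Z j ⊆ X j`, the white bundles are matched
injectively, and only matched white bundles have a nonempty red bundle next to them. -/
structure Layout (s : State n m) : Prop where
  disjoint : ∀ i j x, x ∈ s.X i → x ∈ s.X j → i = j
  subset : ∀ j x, x ∈ s.Z j → x ∈ s.X j
  blue_disjoint : ∀ i B, s.M i = .blue B → ∀ j, ∀ x ∈ B, x ∉ s.X j
  blue_blue : ∀ i i' B B', s.M i = .blue B → s.M i' = .blue B' → ∀ x ∈ B, x ∈ B' → i = i'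
  white_inj : ∀ i i' j, s.M i = .white j → s.M i' = .white j → i = i'
  red_matched : ∀ j, s.Z j ≠ s.X j → ∃ i, s.M i = .white j

/-- An agent `i` with value `w` is `α`-envy-free towards the available bundles. -/
structure Safe (α : ℝ) (v : Valuations n m) (s : State n m) (i : Fin n) (w : ℝ) : Prop where
  white_le : ∀ j, ∀ z ∈ s.Z j, α * v i ((s.Z j).erase z) ≤ w
  red_le : ∀ j, α * v i (s.X j \ s.Z j) ≤ w
  blue_le : ∀ u C, s.M u = .blue C → ∀ z ∈ C, α * v i (C.erase z) ≤ w

/-- An agent `i` with value `w` is also `α`-envy-free towards the sets `X j` minus an item of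
`Z j`. -/
structure Robust (α : ℝ) (v : Valuations n m) (s : State n m) (i : Fin n) (w : ℝ) : Prop
    extends Safe α v s i w where
  large_le : ∀ j, ∀ z ∈ s.Z j, α * v i ((s.X j).erase z) ≤ w

/-- Matched agents are safe; agents not matched to their own white bundle are robust. -/
structure Tolerant (α : ℝ) (v : Valuations n m) (s : State n m) : Prop where
  safe : ∀ i, s.M i = .white i → s.Safe α v i (v i (s.Z i))
  robust : ∀ i B, s.M i ≠ .white i → s.Holds i B → s.Robust α v i (v i B)

/-- The welfare accounting: `y j` is the value credited to agent `j`, and the product of the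
credits has dropped from `P` by at most a factor `α / (α + 1)` for every blue bundle. -/
structure Credit (α : ℝ) (v : Valuations n m) (P : ℝ) (s : State n m) (y : Fin n → ℝ) :
    Prop where
  nonneg : ∀ j, 0 ≤ y j
  le_X : ∀ j, y j ≤ v j (s.X j)
  le_Z : ∀ j, y j ≤ (α + 1) * v j (s.Z j)
  le_other : ∀ j B, s.M j ≠ .white j → s.Holds j B → y j ≤ (α + 1) * (α * v j B)
  le_free : ∀ j B, s.M j ≠ .white j → s.Holds j B → (∀ u, s.M u ≠ .white j) → y j ≤ α * v j B
  prod_le : P * (α / (α + 1)) ^ s.blueCount ≤ ∏ j, y j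
  -- Allows the factors `α` of the blue bundles to be cancelled at the end, even though `α = 0` is
  -- permitted.
  pos : ∀ i B, s.M i = .blue B → 0 < α

/-- The invariant of the loop. -/
structure Inv (α : ℝ) (v : Valuations n m) (P : ℝ) (s : State n m) : Prop where
  layout : s.Layout
  tolerant : s.Tolerant α v
  credit : ∃ y, s.Credit α v P y

theorem IsFavorite.lt_of_not_selfGood {α : ℝ} {v : Valuations n m} {s : State n m} {i : Fin n}
    {J : Finset (Fin m)} (hα0 : 0 ≤ α) (h : ¬ s.SelfGood α v i) (hJ : s.IsFavorite v i J) :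
    v i (s.Z i) < α * v i J := by
  unfold SelfGood at h
  push Not at h
  obtain ⟨J', hJ', h⟩ := h
  exact h.trans_le (mul_le_mul_of_nonneg_left (hJ.2 J' hJ') hα0)

theorem safe_iff {α : ℝ} {v : Valuations n m} {s : State n m} {i : Fin n} {w : ℝ} :
    s.Safe α v i w ↔ ∀ J, s.Avail J → α * v i J ≤ w := by
  simp only [avail_iff]
  constructor
  · rintro ⟨h1, h2, h3⟩ J (⟨j, g, hg, rfl⟩ | ⟨j, rfl⟩ | ⟨u, C, hC, g, hg, rfl⟩)
    · exact h1 j g hg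
    · exact h2 j
    · exact h3 u C hC g hg
  · intro h
    exact ⟨fun j z hz => h _ (.inl ⟨j, z, hz, rfl⟩), fun j => h _ (.inr (.inl ⟨j, rfl⟩)),
      fun u C hC z hz => h _ (.inr (.inr ⟨u, C, hC, z, hz, rfl⟩))⟩

/-- `X j` minus `z` is covered by the red bundle at `j` and `Z j` minus `z`, each worth at most `w`.
Its value is thus at most `2 * w`, and `α ≤ 1 / 2` absorbs the 2. -/
theorem robust_of_forall_avail {α : ℝ} {v : Valuations n m} {s : State n m} {i : Fin n} {w : ℝ}
    (hmono : IsMonotone v) (hsub : IsSubadditive v) (hα : α ≤ 1 / 2)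
    (h : ∀ J, s.Avail J → v i J ≤ w) : s.Robust α v i w := by
  refine ⟨safe_iff.2 fun J hJ => ?_, fun j z hz => ?_⟩
  · nlinarith [h J hJ, hmono.1 i J, hα]
  have h1 := h _ (.inl ⟨j, z, hz, rfl⟩)
  have h2 := h _ (.inr (.inl ⟨j, rfl⟩))
  have h3 : v i ((s.X j).erase z) ≤ v i (s.X j \ s.Z j ∪ (s.Z j).erase z) :=
    hmono.2 _ _ _ (by intro x; simp; tauto)
  have h4 := hsub i (s.X j \ s.Z j) ((s.Z j).erase z)
  have h0 := hmono.1 i ((s.X j).erase z)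
  nlinarith [hα]

variable {α : ℝ} {v : Valuations n m} {P P' d : ℝ} {s s' : State n m} {y : Fin n → ℝ}
  {i j : Fin n} {g : Fin m} {J W B S : Finset (Fin m)} {X : Bundles n m}

/-! ### Preservation of the layout -/

/-- Every iteration is composed of five elementary moves, each treated once per part of the
invariant. In `self`, `i` takes its own white bundle; in `steal`, part of a blue bundle. In `pass`,
`Z j` becomes `J` and goes to `i` as a white bundle. In `carve`, `J` leaves as a blue bundle and `W`
replaces both `X j` and `Z j`. In `settle`, `i` gets a blue bundle and `X j` shrinks. The new state
is described pointwise, so that intermediate states which the algorithm never visits are covered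
too. -/
theorem Layout.self (h : s.Layout) (hi : s.M i = .unmatched)
    (hX : ∀ l, s'.X l = s.X l) (hZ : ∀ l, s'.Z l = s.Z l)
    (hM : ∀ l, s'.M l = if l = i then .white i else if s.M l = .white i then .unmatched
      else s.M l) :
    s'.Layout := by
  obtain ⟨h1, h2, h3, h4, h5, h6⟩ := h
  constructor
  all_goals grind

theorem Layout.steal (h : s.Layout) (hi : s.M i = .unmatched) (hB : s.M j = .blue B) (hJ : J ⊆ B)
    (hX : ∀ l, s'.X l = s.X l) (hZ : ∀ l, s'.Z l = s.Z l)
    (hM : ∀ l, s'.M l = if l = i then .blue J else if l = j then .unmatched else s.M l) :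
    s'.Layout := by
  obtain ⟨h1, h2, h3, h4, h5, h6⟩ := h
  constructor
  all_goals grind

theorem Layout.pass (h : s.Layout) (hi : s.M i = .unmatched) (hJ : J ⊆ W) (hW : W ⊆ s.X j)
    (hX : ∀ l, s'.X l = if l = j then W else s.X l)
    (hZ : ∀ l, s'.Z l = if l = j then J else s.Z l)
    (hM : ∀ l, s'.M l = if l = i then .white j else if s.M l = .white j then .unmatched
      else s.M l) :
    s'.Layout := by
  obtain ⟨h1, h2, h3, h4, h5, h6⟩ := h
  constructor
  all_goals grind

theorem Layout.carve (h : s.Layout) (hi : s.M i = .unmatched) (hJ : J ⊆ s.Z j)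
    (hW : W ⊆ s.X j \ J)
    (hX : ∀ l, s'.X l = if l = j then W else s.X l)
    (hZ : ∀ l, s'.Z l = if l = j then W else s.Z l)
    (hM : ∀ l, s'.M l = if l = i then .blue J else if s.M l = .white j then .unmatched
      else s.M l) :
    s'.Layout := by
  obtain ⟨h1, h2, h3, h4, h5, h6⟩ := h
  constructor
  all_goals grind

theorem Layout.settle (h : s.Layout) (hi : s.M i = .unmatched ∨ i = j ∧ s.M i = .white i)
    (hS : ∀ l, l ≠ j → ∀ x ∈ S, x ∉ s.X l) (hS' : ∀ x ∈ S, x ∉ s.Z j)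
    (hSB : ∀ l B, s.M l = .blue B → ∀ x ∈ S, x ∉ B)
    (hX : ∀ l, s'.X l = if l = j then s.Z l else s.X l) (hZ : ∀ l, s'.Z l = s.Z l)
    (hM : ∀ l, s'.M l = if l = i then .blue S else s.M l) :
    s'.Layout := by
  obtain ⟨h1, h2, h3, h4, h5, h6⟩ := h
  constructor
  all_goals grind

/-! ### Preservation of tolerance -/

theorem Tolerant.self (h : s.Tolerant α v) (hgood : s.Safe α v i (v i (s.Z i)))
    (hX : ∀ l, s'.X l = s.X l) (hZ : ∀ l, s'.Z l = s.Z l)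
    (hM : ∀ l, s'.M l = if l = i then .white i else if s.M l = .white i then .unmatched
      else s.M l) :
    s'.Tolerant α v := by
  have key : ∀ l w, s.Safe α v l w → s'.Safe α v l w := fun l w hs =>
    ⟨by simpa only [hZ] using hs.white_le, by simpa only [hX, hZ] using hs.red_le,
      fun u C hC => hs.blue_le u C (by grind)⟩
  refine ⟨fun l hl => ?_, fun l B hl hB => ?_⟩
  · rw [hZ]
    by_cases hli : l = i
    · exact hli ▸ key _ _ hgood
    · exact key _ _ (h.safe l (by grind))
  · have hr := h.robust l B (by grind) (by unfold Holds at *; grind)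
    exact ⟨key _ _ hr.toSafe, by simpa only [hX, hZ] using hr.large_le⟩

theorem Tolerant.steal (h : s.Tolerant α v) (hm : ∀ i S T, S ⊆ T → α * v i S ≤ α * v i T)
    (hB : s.M j = .blue B) (hJ : J ⊆ B) (hr : s.Robust α v i (v i J))
    (hX : ∀ l, s'.X l = s.X l) (hZ : ∀ l, s'.Z l = s.Z l)
    (hM : ∀ l, s'.M l = if l = i then .blue J else if l = j then .unmatched else s.M l) :
    s'.Tolerant α v := by
  have key : ∀ l w, s.Safe α v l w → s'.Safe α v l w := fun l w hs =>
    ⟨by simpa only [hZ] using hs.white_le, by simpa only [hX, hZ] using hs.red_le,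
      fun u C hC z hz => by
        by_cases hu : u = i
        · obtain rfl : J = C := by grind
          exact (hm _ _ _ (Finset.erase_subset_erase _ hJ)).trans (hs.blue_le j B hB z (hJ hz))
        · exact hs.blue_le u C (by grind) z hz⟩
  have key' : ∀ l w, s.Robust α v l w → s'.Robust α v l w := fun l w hs =>
    ⟨key _ _ hs.toSafe, by simpa only [hX, hZ] using hs.large_le⟩
  refine ⟨fun l hl => ?_, fun l B hl hB => ?_⟩
  · rw [hZ]
    exact key _ _ (h.safe l (by grind))
  · by_cases hli : l = i
    · obtain rfl : J = B := by unfold Holds at hB; grind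
      exact hli ▸ key' _ _ hr
    · exact key' _ _ (h.robust l B (by grind) (by unfold Holds at *; grind))

/-- The only new threat is the red bundle `W \ J`. It lies in `X j` and misses an item of `J ⊆ Z j`,
so robust agents tolerate it; for agents holding their own white bundle this is the hypothesis
`hself`. -/
theorem Tolerant.pass (h : s.Tolerant α v) (hm : ∀ i S T, S ⊆ T → α * v i S ≤ α * v i T)
    (hij : i ≠ j) (hJ : J ⊆ s.Z j) (hJ0 : J.Nonempty) (hW : W ⊆ s.X j)
    (hr : s.Robust α v i (v i J))
    (hself : ∀ l, s.M l = .white l → l ≠ j → α * v l (W \ J) ≤ v l (s.Z l))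
    (hX : ∀ l, s'.X l = if l = j then W else s.X l)
    (hZ : ∀ l, s'.Z l = if l = j then J else s.Z l)
    (hM : ∀ l, s'.M l = if l = i then .white j else if s.M l = .white j then .unmatched
      else s.M l) :
    s'.Tolerant α v := by
  obtain ⟨z₀, hz₀⟩ := hJ0
  have key : ∀ l w, s.Safe α v l w → α * v l (W \ J) ≤ w → s'.Safe α v l w := by
    refine fun l w hs hw => ⟨fun k z hz => ?_, fun k => ?_, fun u C hC => hs.blue_le u C (by grind)⟩
    · rw [hZ] at hz ⊢
      split_ifs at hz ⊢ with hk
      · exact (hm _ _ _ (Finset.erase_subset_erase _ hJ)).trans (hs.white_le j z (hJ hz))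
      · exact hs.white_le k z hz
    · rw [hZ, hX]
      split_ifs
      · exact hw
      · exact hs.red_le k
  have key' : ∀ l w, s.Robust α v l w → s'.Robust α v l w := by
    refine fun l w hs => ⟨key _ _ hs.toSafe ((hm _ _ _ ?_).trans (hs.large_le j z₀ (hJ hz₀))),
      fun k z hz => ?_⟩
    · intro x; simp only [Finset.mem_sdiff, Finset.mem_erase]; grind
    · rw [hZ] at hz
      rw [hX]
      split_ifs at hz ⊢
      · exact (hm _ _ _ (Finset.erase_subset_erase _ hW)).trans (hs.large_le j z (hJ hz))
      · exact hs.large_le k z hz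
  refine ⟨fun l hl => ?_, fun l B hl hB => ?_⟩
  · have hlj : l ≠ j := by grind
    have hMl : s.M l = .white l := by grind
    rw [hZ, if_neg hlj]
    exact key _ _ (h.safe l hMl) (hself l hMl hlj)
  · by_cases hli : l = i
    · obtain rfl : J = B := by unfold Holds at hB; grind
      exact hli ▸ key' _ _ hr
    · exact key' _ _ (h.robust l B (by unfold Holds at hB; grind) (by unfold Holds at *; grind))

/-- As in `pass`, `W` misses an item of `J ⊆ Z j`, so robustness covers it. The new blue bundle `J`
is harmless because it was available before. -/
theorem Tolerant.carve (h : s.Tolerant α v) (hm : ∀ i S T, S ⊆ T → α * v i S ≤ α * v i T)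
    (hg : g ∈ s.Z j) (hJ : J = (s.Z j).erase g) (hJ0 : J.Nonempty) (hW : W ⊆ s.X j \ J)
    (hr : s.Robust α v i (v i J))
    (hself : ∀ l, s.M l = .white l → l ≠ j → ∀ z ∈ W, α * v l (W.erase z) ≤ v l (s.Z l))
    (hX : ∀ l, s'.X l = if l = j then W else s.X l)
    (hZ : ∀ l, s'.Z l = if l = j then W else s.Z l)
    (hM : ∀ l, s'.M l = if l = i then .blue J else if s.M l = .white j then .unmatched
      else s.M l) :
    s'.Tolerant α v := by
  obtain ⟨z₀, hz₀⟩ := hJ0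
  have key : ∀ l w, s.Safe α v l w → (∀ z ∈ W, α * v l (W.erase z) ≤ w) → s'.Safe α v l w := by
    refine fun l w hs hw => ⟨fun k z hz => ?_, fun k => ?_, fun u C hC z hz => ?_⟩
    · rw [hZ] at hz ⊢
      split_ifs at hz ⊢
      · exact hw z hz
      · exact hs.white_le k z hz
    · rw [hZ, hX]
      split_ifs
      · exact (hm _ _ _ (by simp)).trans (hs.red_le j)
      · exact hs.red_le k
    · by_cases hu : u = i
      · obtain rfl : J = C := by grind
        exact (hm _ _ _ (by rw [hJ]; exact Finset.erase_subset _ _)).trans (hs.white_le j g hg)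
      · exact hs.blue_le u C (by grind) z hz
  have key' : ∀ l w, s.Robust α v l w → s'.Robust α v l w := by
    intro l w hs
    have hw : ∀ z ∈ W, α * v l (W.erase z) ≤ w := fun z hz =>
      (hm _ _ _ (by intro x; simp only [Finset.mem_erase]; grind)).trans
        (hs.large_le j z₀ (by grind))
    refine ⟨key _ _ hs.toSafe hw, fun k z hz => ?_⟩
    rw [hZ] at hz
    rw [hX]
    split_ifs at hz ⊢
    · exact hw z hz
    · exact hs.large_le k z hz
  refine ⟨fun l hl => ?_, fun l B hl hB => ?_⟩
  · have hlj : l ≠ j := by grind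
    have hMl : s.M l = .white l := by grind
    rw [hZ, if_neg hlj]
    exact key _ _ (h.safe l hMl) (hself l hMl hlj)
  · by_cases hli : l = i
    · obtain rfl : J = B := by unfold Holds at hB; grind
      exact hli ▸ key' _ _ hr
    · exact key' _ _ (h.robust l B (by unfold Holds at hB; grind) (by unfold Holds at *; grind))

theorem Tolerant.settle (h : s.Tolerant α v) (hm : ∀ i S T, S ⊆ T → α * v i S ≤ α * v i T)
    (hm1 : ∀ i S, α * v i S ≤ v i S) (hZX : s.Z j ⊆ s.X j)
    (hr : s.Robust α v i (v i S))
    (hself : ∀ l, l ≠ i → s.M l = .white l → ∀ z ∈ S, α * v l (S.erase z) ≤ v l (s.Z l))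
    (hrob : ∀ l B, s.M l ≠ .white l → s.Holds l B → ∀ z ∈ S, α * v l (S.erase z) ≤ v l B)
    (hX : ∀ l, s'.X l = if l = j then s.Z l else s.X l) (hZ : ∀ l, s'.Z l = s.Z l)
    (hM : ∀ l, s'.M l = if l = i then .blue S else s.M l) :
    s'.Tolerant α v := by
  have key : ∀ l w, s.Safe α v l w → (∀ z ∈ S, α * v l (S.erase z) ≤ w) → s'.Safe α v l w := by
    refine fun l w hs hw =>
      ⟨by simpa only [hZ] using hs.white_le, fun k => ?_, fun u C hC z hz => ?_⟩
    · rw [hZ, hX]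
      split_ifs
      · exact (hm _ _ _ (by simp)).trans (hs.red_le j)
      · exact hs.red_le k
    · by_cases hu : u = i
      · obtain rfl : S = C := by grind
        exact hw z hz
      · exact hs.blue_le u C (by grind) z hz
  have key' : ∀ l w, s.Robust α v l w → (∀ z ∈ S, α * v l (S.erase z) ≤ w) →
      s'.Robust α v l w := by
    refine fun l w hs hw => ⟨key _ _ hs.toSafe hw, fun k z hz => ?_⟩
    rw [hZ] at hz
    rw [hX]
    split_ifs with hk
    · subst hk
      exact (hm _ _ _ (Finset.erase_subset_erase _ hZX)).trans (hs.large_le k z hz)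
    · exact hs.large_le k z hz
  refine ⟨fun l hl => ?_, fun l B hl hB => ?_⟩
  · have hli : l ≠ i := by grind
    have hMl : s.M l = .white l := by grind
    rw [hZ]
    exact key _ _ (h.safe l hMl) (hself l hli hMl)
  · by_cases hli : l = i
    · obtain rfl : S = B := by unfold Holds at hB; grind
      subst hli
      exact key' _ _ hr fun z _ => (hm _ _ _ (Finset.erase_subset _ _)).trans (hm1 _ _)
    · have hB' : s.Holds l B := by unfold Holds at *; grind
      have hl' : s.M l ≠ .white l := by grind
      exact key' _ _ (h.robust l B hl' hB') (hrob l B hl' hB')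

/-! ### Preservation of the welfare accounting -/

theorem blueCount_le_of_injective (f : Fin n → Fin n) (hf : f.Injective)
    (h : ∀ l B, s.M l = .blue B → ∃ B', s'.M (f l) = .blue B') :
    s.blueCount ≤ s'.blueCount := by
  refine Finset.card_le_card_of_injOn f (fun l hl => ?_) hf.injOn
  simp only [Finset.coe_filter, Finset.mem_univ, true_and, Set.mem_ofPred_eq] at hl ⊢
  obtain ⟨B, hB⟩ := hl
  exact h l B hB

theorem blueCount_succ_le (hi : ∀ B, s.M i ≠ .blue B) (hi' : s'.M i = .blue J)
    (h : ∀ l B, s.M l = .blue B → s'.M l = .blue B) :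
    s.blueCount + 1 ≤ s'.blueCount := by
  refine Finset.card_lt_card ((Finset.ssubset_iff_of_subset fun l => ?_).2 ⟨i, ?_, ?_⟩)
  · simp only [Finset.mem_filter, Finset.mem_univ, true_and]
    exact fun ⟨B, hB⟩ => ⟨B, h l B hB⟩
  · simp [hi']
  · simp [hi]

theorem prod_scale (y : Fin n → ℝ) (j : Fin n) (d : ℝ) :
    ∏ l, (if l = j then d * y l else y l) = d * ∏ l, y l := by
  rw [← Finset.mul_prod_erase _ _ (Finset.mem_univ j),
    ← Finset.mul_prod_erase (Finset.univ) y (Finset.mem_univ j), if_pos rfl, mul_assoc]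
  congr 2
  exact Finset.prod_congr rfl fun l hl => if_neg (Finset.ne_of_mem_erase hl)

/-- The bookkeeping rule: scaling one credit by `d` is paid for by `e` new blue bundles, worth `c`
each, and by the change of the target from `P` to `P'`. -/
theorem mul_pow_le_prod_scale {c : ℝ} {b b' e : ℕ} (hc0 : 0 ≤ c) (hc1 : c ≤ 1) (hP' : 0 ≤ P')
    (hd : 0 ≤ d) (hP : P' * c ^ e ≤ d * P) (hb : b + e ≤ b') (h : P * c ^ b ≤ ∏ l, y l) :
    P' * c ^ b' ≤ ∏ l, (if l = j then d * y l else y l) := by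
  rw [prod_scale]
  calc P' * c ^ b' ≤ P' * c ^ (b + e) :=
        mul_le_mul_of_nonneg_left (pow_le_pow_of_le_one hc0 hc1 hb) hP'
    _ = P' * c ^ e * c ^ b := by ring
    _ ≤ d * P * c ^ b := mul_le_mul_of_nonneg_right hP (pow_nonneg hc0 _)
    _ = d * (P * c ^ b) := by ring
    _ ≤ _ := mul_le_mul_of_nonneg_left h hd

theorem ratio_nonneg (hα0 : 0 ≤ α) : 0 ≤ α / (α + 1) := by positivity

theorem ratio_le_one (hα0 : 0 ≤ α) : α / (α + 1) ≤ 1 := by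
  rw [div_le_one (by linarith)]; linarith

theorem Credit.le_of_lift (h : s.Credit α v P y) (hα0 : 0 ≤ α) (hw : v i (s.Z i) < α * v i J) :
    y i ≤ (α + 1) * (α * v i J) :=
  (h.le_Z i).trans (mul_le_mul_of_nonneg_left hw.le (by linarith))

/-- A free white bundle has no red part, so `Z i = X i` and the bound by `v i (X i)` applies, which
saves the factor `α + 1`. -/
theorem Credit.le_of_lift_of_free (h : s.Credit α v P y) (hl : s.Layout)
    (hw : v i (s.Z i) < α * v i J) (hfree : ∀ u, s.M u ≠ .white i) :
    y i ≤ α * v i J := by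
  have hZX : s.Z i = s.X i := by
    by_contra hne
    obtain ⟨u, hu⟩ := hl.red_matched i hne
    exact hfree u hu
  exact (h.le_X i).trans (hZX ▸ hw.le)

theorem Credit.self (h : s.Credit α v P y) (hα0 : 0 ≤ α) (hi : s.M i = .unmatched)
    (hP' : 0 ≤ P)
    (hX : ∀ l, s'.X l = s.X l) (hZ : ∀ l, s'.Z l = s.Z l)
    (hM : ∀ l, s'.M l = if l = i then .white i else if s.M l = .white i then .unmatched
      else s.M l) :
    s'.Credit α v P y := by
  have hold : ∀ l B, s'.M l ≠ .white l → s'.Holds l B → s.M l ≠ .white l ∧ s.Holds l B := by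
    intro l B hl hB
    unfold Holds at *
    grind
  refine ⟨h.nonneg, by simpa only [hX] using h.le_X, by simpa only [hZ] using h.le_Z,
    fun l B hl hB => h.le_other l B (hold l B hl hB).1 (hold l B hl hB).2,
    fun l B hl hB hu => h.le_free l B (hold l B hl hB).1 (hold l B hl hB).2 (by grind), ?_,
    fun l B hB => h.pos l B (by grind)⟩
  refine le_trans (mul_le_mul_of_nonneg_left (pow_le_pow_of_le_one (ratio_nonneg hα0)
    (ratio_le_one hα0) (blueCount_le_of_injective id Function.injective_id ?_)) hP') h.prod_le
  grind

theorem Credit.steal (h : s.Credit α v P y) (hl : s.Layout) (hα0 : 0 ≤ α)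
    (hi : s.M i = .unmatched) (hB : s.M j = .blue B) (hP' : 0 ≤ P)
    (hw : v i (s.Z i) < α * v i J)
    (hX : ∀ l, s'.X l = s.X l) (hZ : ∀ l, s'.Z l = s.Z l)
    (hM : ∀ l, s'.M l = if l = i then .blue J else if l = j then .unmatched else s.M l) :
    s'.Credit α v P y := by
  have hold : ∀ l B, s'.M l ≠ .white l → s'.Holds l B →
      l = i ∧ B = J ∨ s.M l ≠ .white l ∧ s.Holds l B := by
    intro l B hl hB
    unfold Holds at *
    grind
  refine ⟨h.nonneg, by simpa only [hX] using h.le_X, by simpa only [hZ] using h.le_Z,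
    fun l B hlw hlB => ?_, fun l B hlw hlB hu => ?_, ?_, fun l B' hB' => ?_⟩
  · obtain ⟨rfl, rfl⟩ | ⟨h1, h2⟩ := hold l B hlw hlB
    · exact h.le_of_lift hα0 hw
    · exact h.le_other l B h1 h2
  · have hu' : ∀ u, s.M u ≠ .white l := by grind
    obtain ⟨rfl, rfl⟩ | ⟨h1, h2⟩ := hold l B hlw hlB
    · exact h.le_of_lift_of_free hl hw hu'
    · exact h.le_free l B h1 h2 hu'
  -- The number of blue bundles does not drop: swapping `i` and `j` sends the robbed agent to the
  -- agent that took its bundle.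
  · refine le_trans (mul_le_mul_of_nonneg_left (pow_le_pow_of_le_one (ratio_nonneg hα0)
      (ratio_le_one hα0) (blueCount_le_of_injective (Equiv.swap i j) (Equiv.injective _) ?_)) hP')
      h.prod_le
    intro l C hC
    by_cases hlj : l = j
    · exact ⟨J, by rw [hlj, Equiv.swap_apply_right, hM, if_pos rfl]⟩
    · have hli : l ≠ i := by grind
      exact ⟨C, by rw [Equiv.swap_apply_of_ne_of_ne hli hlj, hM, if_neg hli, if_neg hlj, hC]⟩
  · exact h.pos j B hB

theorem Credit.pass (h : s.Credit α v P y) (hl : s.Layout) (hα : 0 < α) (hij : i ≠ j)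
    (hi : s.M i = .unmatched) (hd0 : 0 ≤ d) (hd1 : d ≤ 1) (hP' : 0 ≤ P') (hP : P' ≤ d * P)
    (hw : v i (s.Z i) < α * v i J)
    (hWv : d * v j (s.X j) ≤ v j W) (hJv : d * v j (s.X j) ≤ (α + 1) * v j J)
    (hX : ∀ l, s'.X l = if l = j then W else s.X l)
    (hZ : ∀ l, s'.Z l = if l = j then J else s.Z l)
    (hM : ∀ l, s'.M l = if l = i then .white j else if s.M l = .white j then .unmatched
      else s.M l) :
    s'.Credit α v P' (fun l => if l = j then d * y l else y l) := by
  have hle : ∀ l, (if l = j then d * y l else y l) ≤ y l := fun l => by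
    split_ifs
    · exact mul_le_of_le_one_left (h.nonneg l) hd1
    · exact le_rfl
  have hold : ∀ l B, s'.M l ≠ .white l → s'.Holds l B →
      l = i ∧ B = J ∨ s.M l ≠ .white l ∧ s.Holds l B := by
    intro l B hl hB
    unfold Holds at *
    grind
  refine ⟨fun l => ?_, fun l => ?_, fun l => ?_, fun l B hlw hlB => (hle l).trans ?_,
    fun l B hlw hlB hu => (hle l).trans ?_, ?_, fun _ _ _ => hα⟩
  · split_ifs
    · exact mul_nonneg hd0 (h.nonneg l)
    · exact h.nonneg l
  · rw [hX]
    split_ifs with hlj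
    · subst hlj
      exact (mul_le_mul_of_nonneg_left (h.le_X l) hd0).trans hWv
    · exact h.le_X l
  · rw [hZ]
    split_ifs with hlj
    · subst hlj
      exact (mul_le_mul_of_nonneg_left (h.le_X l) hd0).trans hJv
    · exact h.le_Z l
  · obtain ⟨rfl, rfl⟩ | ⟨h1, h2⟩ := hold l B hlw hlB
    · exact h.le_of_lift hα.le hw
    · exact h.le_other l B h1 h2
  · have hu' : ∀ u, s.M u ≠ .white l := by grind
    obtain ⟨rfl, rfl⟩ | ⟨h1, h2⟩ := hold l B hlw hlB
    · exact h.le_of_lift_of_free hl hw hu'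
    · exact h.le_free l B h1 h2 hu'
  · refine mul_pow_le_prod_scale (e := 0) (ratio_nonneg hα.le) (ratio_le_one hα.le) hP' hd0
      (by simpa using hP) (blueCount_le_of_injective id Function.injective_id ?_) h.prod_le
    grind

theorem Credit.carve (h : s.Credit α v P y) (hl : s.Layout) (hα : 0 < α) (hij : i ≠ j)
    (hi : s.M i = .unmatched) (hd0 : 0 ≤ d) (hd1 : d ≤ 1 / (α + 1)) (hP' : 0 ≤ P')
    (hP : P' * (α / (α + 1)) ≤ d * P)
    (hv : ∀ i S, 0 ≤ v i S)
    (hw : v i (s.Z i) < α * v i J) (hWv : d * v j (s.X j) ≤ v j W)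
    (hX : ∀ l, s'.X l = if l = j then W else s.X l)
    (hZ : ∀ l, s'.Z l = if l = j then W else s.Z l)
    (hM : ∀ l, s'.M l = if l = i then .blue J else if s.M l = .white j then .unmatched
      else s.M l) :
    s'.Credit α v P' (fun l => if l = j then d * y l else y l) := by
  have hα1 : 0 < α + 1 := by linarith
  have hd1' : d ≤ 1 := hd1.trans (by rw [div_le_one hα1]; linarith)
  have hle : ∀ l, (if l = j then d * y l else y l) ≤ y l := fun l => by
    split_ifs
    · exact mul_le_of_le_one_left (h.nonneg l) hd1'
    · exact le_rfl
  have hW : d * y j ≤ v j W := (mul_le_mul_of_nonneg_left (h.le_X j) hd0).trans hWv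
  have hold : ∀ l B, s'.M l ≠ .white l → s'.Holds l B →
      l = i ∧ B = J ∨ l = j ∧ s'.M l = .unmatched ∨ s.M l ≠ .white l ∧ s.Holds l B := by
    intro l B hl hB
    unfold Holds at *
    grind
  have hnot : ∀ l B, s'.M l = .unmatched → s'.Holds l B → False := by
    intro l B hl hB
    unfold Holds at *
    grind
  refine ⟨fun l => ?_, fun l => ?_, fun l => ?_, fun l B hlw hlB => (hle l).trans ?_,
    fun l B hlw hlB hu => ?_, ?_, fun _ _ _ => hα⟩
  · split_ifs
    · exact mul_nonneg hd0 (h.nonneg l)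
    · exact h.nonneg l
  · rw [hX]
    split_ifs with hlj
    · exact hlj ▸ hW
    · exact h.le_X l
  · rw [hZ]
    split_ifs with hlj
    · subst hlj
      nlinarith [hv l W]
    · exact h.le_Z l
  · obtain ⟨rfl, rfl⟩ | ⟨-, h1⟩ | ⟨h1, h2⟩ := hold l B hlw hlB
    · exact h.le_of_lift hα.le hw
    · exact (hnot l B h1 hlB).elim
    · exact h.le_other l B h1 h2
  · obtain ⟨rfl, rfl⟩ | ⟨-, h1⟩ | ⟨h1, h2⟩ := hold l B hlw hlB
    · exact (hle l).trans (h.le_of_lift_of_free hl hw (by grind))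
    · exact (hnot l B h1 hlB).elim
    · by_cases hlj : l = j
      · rw [if_pos hlj]
        -- Agent `j` may hold another bundle while `Z j` becomes free. Its credit must then meet the
        -- stricter bound, and scaling by `d ≤ 1 / (α + 1)` achieves exactly that.
        calc d * y l ≤ 1 / (α + 1) * y l := mul_le_mul_of_nonneg_right hd1 (h.nonneg l)
          _ ≤ 1 / (α + 1) * ((α + 1) * (α * v l B)) :=
            mul_le_mul_of_nonneg_left (h.le_other l B h1 h2) (by positivity)
          _ = α * v l B := by field_simp
      · exact (hle l).trans (h.le_free l B h1 h2 (by grind))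
  · refine mul_pow_le_prod_scale (e := 1) (ratio_nonneg hα.le) (ratio_le_one hα.le) hP' hd0
      (by simpa using hP) (blueCount_succ_le (i := i) (J := J) ?_ ?_ ?_) h.prod_le
    all_goals grind

/-- Shrinking `X j` to `Z j` costs a factor `1 / (α + 1)` of the credit of `j`, by the bound against
`Z j`. The new blue bundle pays for `α / (α + 1)`, so a factor `α` is left over; `hP` lets it repay
an earlier loss. -/
theorem Credit.settle (h : s.Credit α v P y) (hl : s.Layout) (hα : 0 < α)
    (hi : s.M i = .unmatched ∨ i = j ∧ s.M i = .white i)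
    (hP' : 0 ≤ P') (hP : P' * α ≤ P)
    (hw : v i (s.Z i) < α * v i S)
    (hX : ∀ l, s'.X l = if l = j then s.Z l else s.X l) (hZ : ∀ l, s'.Z l = s.Z l)
    (hM : ∀ l, s'.M l = if l = i then .blue S else s.M l) :
    s'.Credit α v P' (fun l => if l = j then 1 / (α + 1) * y l else y l) := by
  have hα1 : 0 < α + 1 := by linarith
  have hle : ∀ l, (if l = j then 1 / (α + 1) * y l else y l) ≤ y l := fun l => by
    split_ifs
    · exact mul_le_of_le_one_left (h.nonneg l) (by rw [div_le_one hα1]; linarith)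
    · exact le_rfl
  have hZ' : ∀ l, 1 / (α + 1) * y l ≤ v l (s.Z l) := fun l => by
    rw [one_div, inv_mul_le_iff₀ hα1]
    exact h.le_Z l
  have hold : ∀ l B, s'.M l ≠ .white l → s'.Holds l B →
      l = i ∧ B = S ∨ s.M l ≠ .white l ∧ s.Holds l B := by
    intro l B hl hB
    unfold Holds at *
    grind
  refine ⟨fun l => ?_, fun l => ?_, fun l => (hle l).trans ?_, fun l B hlw hlB => (hle l).trans ?_,
    fun l B hlw hlB hu => ?_, ?_, fun _ _ _ => hα⟩
  · split_ifs
    · exact mul_nonneg (by positivity) (h.nonneg l)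
    · exact h.nonneg l
  · rw [hX]
    split_ifs with hlj
    · exact hZ' l
    · exact h.le_X l
  · rw [hZ]
    exact h.le_Z l
  · obtain ⟨rfl, rfl⟩ | ⟨h1, h2⟩ := hold l B hlw hlB
    · exact h.le_of_lift hα.le hw
    · exact h.le_other l B h1 h2
  · obtain ⟨rfl, rfl⟩ | ⟨h1, h2⟩ := hold l B hlw hlB
    · by_cases hlj : l = j
      · rw [if_pos hlj]
        exact (hZ' l).trans hw.le
      · exact (hle l).trans (h.le_of_lift_of_free hl hw (by grind))
    · exact (hle l).trans (h.le_free l B h1 h2 (by grind))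
  · refine mul_pow_le_prod_scale (e := 1) (ratio_nonneg hα.le) (ratio_le_one hα.le) hP'
      (by positivity) ?_ (blueCount_succ_le (i := i) (J := S) ?_ ?_ ?_) h.prod_le
    · rw [pow_one, mul_div_assoc', div_le_iff₀ hα1]
      field_simp
      exact hP
    all_goals grind

/-! ### The potential -/

/-- The blue bundle of agent `i`, or `∅`. -/
def blueSet (s : State n m) (i : Fin n) : Finset (Fin m) :=
  match s.M i with
  | .blue B => B
  | _ => ∅

theorem mem_blueSet_iff {x : Fin m} : x ∈ s.blueSet i ↔ ∃ B, s.M i = .blue B ∧ x ∈ B := by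
  unfold blueSet
  cases h : s.M i <;> simp

/-- The agents matched to their own white bundle. -/
def selfAgents (s : State n m) : Finset (Fin n) :=
  Finset.univ.filter fun i => s.M i = .white i

/-- The total number of items in the sets of a family. -/
def total (f : Bundles n m) : ℕ := ∑ i, (f i).card

theorem total_le {f : Bundles n m} (h : ∀ i j x, x ∈ f i → x ∈ f j → i = j) : total f ≤ m := by
  unfold total
  rw [← Finset.card_biUnion]
  · exact (Finset.card_le_univ _).trans_eq (Fintype.card_fin m)
  · intro i _ j _ hij
    exact Finset.disjoint_left.2 fun x hi hj => hij (h i j x hi hj)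

theorem total_lt {f f' : Bundles n m} (h : ∀ l, f' l ⊆ f l) {x : Fin m} (hx : x ∈ f j)
    (hx' : x ∉ f' j) : total f' < total f :=
  Finset.sum_lt_sum (fun l _ => Finset.card_le_card (h l))
    ⟨j, Finset.mem_univ j, Finset.card_lt_card
      ((Finset.ssubset_iff_of_subset (h j)).2 ⟨x, hx, hx'⟩)⟩

/-- One of the sizes of the sets `X j`, of the white bundles, of the blue bundles, and the number of
agents not matched to their own white bundle has decreased, and the earlier ones are unchanged. -/
def Progress (s s' : State n m) : Prop :=
  total s'.X < total s.X ∨ total s'.X = total s.X ∧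
    (total s'.Z < total s.Z ∨ total s'.Z = total s.Z ∧
      (total s'.blueSet < total s.blueSet ∨ total s'.blueSet = total s.blueSet ∧
        s.selfAgents.card < s'.selfAgents.card))

/-- The lexicographic potential as a number. -/
def potential (s : State n m) : ℕ :=
  ((total s.X * (m + 1) + total s.Z) * (m + 1) + total s.blueSet) * (n + 1) +
    (n - s.selfAgents.card)

/-- One digit of the mixed-radix encoding; only the new low digit has to be bounded by the radix. -/
theorem lex_lt {a a' b b' k : ℕ} (h : a' < a ∨ a' = a ∧ b' < b) (hb : b' < k) :
    a' * k + b' < a * k + b := by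
  rcases h with h | ⟨rfl, h⟩
  · calc a' * k + b' < a' * k + k := by omega
      _ = (a' + 1) * k := by ring
      _ ≤ a * k := Nat.mul_le_mul_right k h
      _ ≤ _ := Nat.le_add_right _ _
  · omega

theorem card_selfAgents_le (s : State n m) : s.selfAgents.card ≤ n :=
  (Finset.card_le_univ _).trans_eq (Fintype.card_fin n)

theorem Layout.total_Z_le (h : s.Layout) : total s.Z ≤ m :=
  total_le fun i j x hi hj => h.disjoint i j x (h.subset i x hi) (h.subset j x hj)

theorem Layout.total_blueSet_le (h : s.Layout) : total s.blueSet ≤ m := by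
  refine total_le fun i j x hi hj => ?_
  obtain ⟨B, hB, hx⟩ := mem_blueSet_iff.1 hi
  obtain ⟨B', hB', hx'⟩ := mem_blueSet_iff.1 hj
  exact h.blue_blue i j B B' hB hB' x hx hx'

theorem Progress.potential_lt (h : Progress s s') (hl : s'.Layout) :
    s'.potential < s.potential := by
  have h1 := hl.total_Z_le
  have h2 := hl.total_blueSet_le
  have h3 := s.card_selfAgents_le
  have h4 := s'.card_selfAgents_le
  unfold potential
  obtain h | ⟨hX, h | ⟨hZ, h | ⟨hB, h⟩⟩⟩ := h
  · exact lex_lt (.inl (lex_lt (.inl (lex_lt (.inl h) (by omega))) (by omega))) (by omega)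
  · exact lex_lt (.inl (lex_lt (.inl (lex_lt (.inr ⟨hX, h⟩) (by omega))) (by omega))) (by omega)
  · rw [hX, hZ]
    exact lex_lt (.inl (lex_lt (.inr ⟨rfl, h⟩) (by omega))) (by omega)
  · rw [hX, hZ, hB]
    omega

theorem Layout.potential_lt (h : s.Layout) : s.potential < (n + 1) * (m + 1) ^ 3 := by
  have h0 : total s.X ≤ m := total_le h.disjoint
  have h1 := h.total_Z_le
  have h2 := h.total_blueSet_le
  have h5 := lex_lt (b := 0) (.inl (Nat.lt_succ_of_le h0)) (Nat.lt_succ_of_le h1)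
  have h6 := lex_lt (b := 0) (.inl h5) (Nat.lt_succ_of_le h2)
  have h7 := lex_lt (b := 0) (.inl h6)
    (show n - s.selfAgents.card < n + 1 by omega)
  refine h7.trans_eq ?_
  simp only [Nat.succ_eq_add_one]
  ring

theorem Progress.of_X (h : ∀ l, s'.X l ⊆ s.X l) {x : Fin m} (hx : x ∈ s.X j) (hx' : x ∉ s'.X j) :
    Progress s s' := .inl (total_lt h hx hx')

theorem Progress.of_Z (hX : ∀ l, s'.X l = s.X l) (h : ∀ l, s'.Z l ⊆ s.Z l) {x : Fin m}
    (hx : x ∈ s.Z j) (hx' : x ∉ s'.Z j) : Progress s s' :=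
  .inr ⟨by rw [funext hX], .inl (total_lt h hx hx')⟩

theorem Progress.of_blue {J B : Finset (Fin m)} {g : Fin m}
    (hi : s.M i = .unmatched) (hB : s.M j = .blue B) (hg : g ∈ B) (hJ : J = B.erase g)
    (hX : ∀ l, s'.X l = s.X l) (hZ : ∀ l, s'.Z l = s.Z l)
    (hM : ∀ l, s'.M l = if l = i then .blue J else if l = j then .unmatched else s.M l) :
    Progress s s' := by
  refine .inr ⟨by rw [funext hX], .inr ⟨by rw [funext hZ], .inl ?_⟩⟩
  -- The blue bundle changes its owner, so the families become comparable pointwise only after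
  -- swapping `i` and `j`.
  have hsum : total s'.blueSet = total (fun l => s'.blueSet (Equiv.swap i j l)) :=
    (Equiv.sum_comp (Equiv.swap i j) (fun l => (s'.blueSet l).card)).symm
  have hij : i ≠ j := by grind
  rw [hsum]
  refine total_lt (j := j) (x := g) (fun l x => ?_) ?_ ?_
  · rw [mem_blueSet_iff, mem_blueSet_iff]
    rintro ⟨C, hC, hx⟩
    by_cases hli : l = i
    · rw [hli, Equiv.swap_apply_left] at hC
      grind
    · by_cases hlj : l = j
      · rw [hlj, Equiv.swap_apply_right] at hC
        grind
      · rw [Equiv.swap_apply_of_ne_of_ne hli hlj] at hC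
        grind
  · exact mem_blueSet_iff.2 ⟨B, hB, hg⟩
  · rw [Equiv.swap_apply_right, mem_blueSet_iff]
    grind

theorem Progress.of_self (hi : s.M i = .unmatched)
    (hX : ∀ l, s'.X l = s.X l) (hZ : ∀ l, s'.Z l = s.Z l)
    (hM : ∀ l, s'.M l = if l = i then .white i else if s.M l = .white i then .unmatched
      else s.M l) :
    Progress s s' := by
  refine .inr ⟨by rw [funext hX], .inr ⟨by rw [funext hZ], .inr ⟨?_, ?_⟩⟩⟩
  · congr 1
    ext l x
    rw [mem_blueSet_iff, mem_blueSet_iff]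
    grind
  · refine Finset.card_lt_card ((Finset.ssubset_iff_of_subset fun l => ?_).2 ⟨i, ?_, ?_⟩)
    · simp only [selfAgents, Finset.mem_filter, Finset.mem_univ, true_and]
      grind
    · simp [selfAgents, hM]
    · simp [selfAgents, hi]

/-! ### The iterations preserve the invariant -/

/-- What is known when an unmatched agent `i` that does not take `Z i` takes the bundle `J`. -/
structure Taking (α : ℝ) (v : Valuations n m) (s : State n m) (i : Fin n)
    (J : Finset (Fin m)) : Prop where
  unmatched : s.M i = .unmatched
  lift : v i (s.Z i) < α * v i J
  pos : 0 < α
  nonempty : J.Nonempty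
  robust : s.Robust α v i (v i J)

theorem mul_value_le (hmono : IsMonotone v) (hα : α ≤ 1 / 2) (i : Fin n) (S : Finset (Fin m)) :
    α * v i S ≤ v i S :=
  mul_le_of_le_one_left (hmono.1 i S) (by linarith)

theorem taking_of_isFavorite (hmono : IsMonotone v) (hsub : IsSubadditive v) (hα0 : 0 ≤ α)
    (hα : α ≤ 1 / 2) (hi : s.M i = .unmatched) (hJ : s.IsFavorite v i J)
    (hgood : ¬ s.SelfGood α v i) : s.Taking α v i J := by
  have hlift := IsFavorite.lt_of_not_selfGood hα0 hgood hJ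
  have hαJ := mul_value_le hmono hα i J
  refine ⟨hi, hlift, hα0.lt_of_ne ?_, ?_, robust_of_forall_avail hmono hsub hα hJ.2⟩
  · rintro rfl
    linarith [hmono.1 i (s.Z i)]
  -- The empty bundle may have positive value, but by monotonicity it is worth at most `Z i`, which
  -- `i` values strictly less than `J`.
  · by_contra h
    rw [Finset.not_nonempty_iff_eq_empty] at h
    rw [h] at hlift hαJ
    linarith [hmono.2 i ∅ (s.Z i) (Finset.empty_subset _)]

theorem Taking.ne (h : s.Taking α v i J) (hmono : IsMonotone v) (hα : α ≤ 1 / 2)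
    (hJ : J ⊆ s.Z j) : i ≠ j := by
  rintro rfl
  linarith [h.lift, mul_value_le hmono hα i J, hmono.2 i _ _ hJ]

theorem Inv.carve (h : s.Inv α v P) (ht : s.Taking α v i J) (hmono : IsMonotone v)
    (hα : α ≤ 1 / 2) (hg : g ∈ s.Z j) (hJ : J = (s.Z j).erase g) (hW : W ⊆ s.X j \ J)
    (hd0 : 0 ≤ d) (hd1 : d ≤ 1 / (α + 1)) (hP' : 0 ≤ P') (hP : P' * (α / (α + 1)) ≤ d * P)
    (hWv : d * v j (s.X j) ≤ v j W)
    (hself : ∀ l, s.M l = .white l → l ≠ j → ∀ z ∈ W, α * v l (W.erase z) ≤ v l (s.Z l))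
    (hX : ∀ l, s'.X l = if l = j then W else s.X l)
    (hZ : ∀ l, s'.Z l = if l = j then W else s.Z l)
    (hM : ∀ l, s'.M l = if l = i then .blue J else if s.M l = .white j then .unmatched
      else s.M l) :
    s'.Inv α v P' := by
  have hJZ : J ⊆ s.Z j := hJ ▸ Finset.erase_subset _ _
  obtain ⟨y, hy⟩ := h.credit
  exact ⟨h.layout.carve ht.unmatched hJZ hW hX hZ hM,
    h.tolerant.carve (fun i S T hST => mul_le_mul_of_nonneg_left (hmono.2 i S T hST) ht.pos.le)
      hg hJ ht.nonempty hW ht.robust hself hX hZ hM,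
    _, hy.carve h.layout ht.pos (ht.ne hmono hα hJZ) ht.unmatched hd0 hd1 hP' hP hmono.1 ht.lift
      hWv hX hZ hM⟩

theorem Inv.pass (h : s.Inv α v P) (ht : s.Taking α v i J) (hmono : IsMonotone v)
    (hα : α ≤ 1 / 2) (hJ : J ⊆ s.Z j) (hJW : J ⊆ W) (hW : W ⊆ s.X j)
    (hd0 : 0 ≤ d) (hd1 : d ≤ 1) (hP' : 0 ≤ P') (hP : P' ≤ d * P)
    (hWv : d * v j (s.X j) ≤ v j W) (hJv : d * v j (s.X j) ≤ (α + 1) * v j J)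
    (hself : ∀ l, s.M l = .white l → l ≠ j → α * v l (W \ J) ≤ v l (s.Z l))
    (hX : ∀ l, s'.X l = if l = j then W else s.X l)
    (hZ : ∀ l, s'.Z l = if l = j then J else s.Z l)
    (hM : ∀ l, s'.M l = if l = i then .white j else if s.M l = .white j then .unmatched
      else s.M l) :
    s'.Inv α v P' := by
  obtain ⟨y, hy⟩ := h.credit
  exact ⟨h.layout.pass ht.unmatched hJW hW hX hZ hM,
    h.tolerant.pass (fun i S T hST => mul_le_mul_of_nonneg_left (hmono.2 i S T hST) ht.pos.le)
      (ht.ne hmono hα hJ) hJ ht.nonempty hW ht.robust hself hX hZ hM,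
    _, hy.pass h.layout ht.pos (ht.ne hmono hα hJ) ht.unmatched hd0 hd1 hP' hP ht.lift
      hWv hJv hX hZ hM⟩

/-- An agent `k` matched to `Z k` moves to a bundle `S` that it prefers to `Z k` by a factor more
than `1 / α`. -/
theorem Inv.move {k : Fin n} (h : s.Inv α v (α * P)) (hmono : IsMonotone v)
    (hsub : IsSubadditive v) (hα0 : 0 < α) (hα : α ≤ 1 / 2) (hP : 0 ≤ P)
    (hk : s.M k = .white k) (hw : v k (s.Z k) < α * v k S)
    (hS : ∀ l, ∀ x ∈ S, x ∉ s.X l)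
    (hSB : ∀ l B, s.M l = .blue B → ∀ x ∈ S, x ∉ B)
    (hself : ∀ l, s.M l = .white l → ∀ z ∈ S, α * v l (S.erase z) ≤ v l (s.Z l))
    (hrob : ∀ l B, s.M l ≠ .white l → s.Holds l B → α * v l S ≤ v l B)
    (hX : ∀ l, s'.X l = if l = k then s.Z l else s.X l) (hZ : ∀ l, s'.Z l = s.Z l)
    (hM : ∀ l, s'.M l = if l = k then .blue S else s.M l) :
    s'.Inv α v P := by
  have hm : ∀ i S T, S ⊆ T → α * v i S ≤ α * v i T :=
    fun i S T hST => mul_le_mul_of_nonneg_left (hmono.2 i S T hST) hα0.le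
  obtain ⟨y, hy⟩ := h.credit
  -- Safety at `Z k` and the envy of `k` give `α * v k J ≤ v k (Z k) < α * v k S`. Cancelling `α`
  -- shows that `S` beats every available bundle.
  have hr : s.Robust α v k (v k S) := robust_of_forall_avail hmono hsub hα fun J hJ =>
    (lt_of_mul_lt_mul_left ((safe_iff.1 (h.tolerant.safe k hk) J hJ).trans_lt hw) hα0.le).le
  exact ⟨h.layout.settle (.inr ⟨rfl, hk⟩) (fun l _ => hS l)
      (fun x hx hx' => hS k x hx (h.layout.subset k x hx')) hSB hX hZ hM,
    h.tolerant.settle hm (mul_value_le hmono hα) (h.layout.subset k) hr (fun l _ => hself l)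
      (fun l B hl hB z _ => (hm _ _ _ (Finset.erase_subset _ _)).trans (hrob l B hl hB)) hX hZ hM,
    _, hy.settle h.layout hα0 (.inr ⟨rfl, hk⟩) hP (mul_comm P α).le hw hX hZ hM⟩

theorem Inv.takeRed (h : s.Inv α v P) (ht : s.Taking α v i J) (hmono : IsMonotone v)
    (hα : α ≤ 1 / 2) (hP : 0 ≤ P) (hJ : J = s.X j \ s.Z j)
    (hX : ∀ l, s'.X l = if l = j then s.Z l else s.X l) (hZ : ∀ l, s'.Z l = s.Z l)
    (hM : ∀ l, s'.M l = if l = i then .blue J else s.M l) :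
    s'.Inv α v P ∧ Progress s s' := by
  have hm : ∀ i S T, S ⊆ T → α * v i S ≤ α * v i T :=
    fun i S T hST => mul_le_mul_of_nonneg_left (hmono.2 i S T hST) ht.pos.le
  have hJX : ∀ x ∈ J, x ∈ s.X j ∧ x ∉ s.Z j := by grind
  have hle : ∀ l w, s.Safe α v l w → ∀ z ∈ J, α * v l (J.erase z) ≤ w := fun l w hs z _ =>
    (hm _ _ _ (Finset.erase_subset _ _)).trans (hJ ▸ hs.red_le j)
  obtain ⟨y, hy⟩ := h.credit
  refine ⟨⟨h.layout.settle (.inl ht.unmatched) ?_ (fun x hx => (hJX x hx).2) ?_ hX hZ hM,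
    h.tolerant.settle hm (mul_value_le hmono hα) (h.layout.subset j) ht.robust
      (fun l _ hl => hle l _ (h.tolerant.safe l hl))
      (fun l B hl hB => hle l _ (h.tolerant.robust l B hl hB).toSafe) hX hZ hM,
    _, hy.settle h.layout ht.pos (.inl ht.unmatched) hP ?_ ht.lift hX hZ hM⟩, ?_⟩
  · intro l hl x hx hx'
    exact hl (h.layout.disjoint l j x hx' (hJX x hx).1)
  · intro l B hB x hx hx'
    exact h.layout.blue_disjoint l B hB j x hx' (hJX x hx).1
  · exact mul_le_of_le_one_right hP (by linarith)
  · obtain ⟨x, hx⟩ := ht.nonempty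
    refine Progress.of_X (j := j) (fun l => ?_) (hJX x hx).1
      (by rw [hX, if_pos rfl]; exact (hJX x hx).2)
    rw [hX]
    split_ifs
    · exact h.layout.subset l
    · exact subset_rfl

/-- The last two iterations of SPLIT, after the bundle `V` became `Z j` and `X j`. -/
theorem Inv.splitMove {s₂ : State n m} {k : Fin n} {V : Finset (Fin m)} (h : s.Inv α v P)
    (ht : s.Taking α v i J) (hmono : IsMonotone v) (hsub : IsSubadditive v) (hα : α ≤ 1 / 2)
    (hP : 0 ≤ P) (hJZ : J ⊆ s.Z j) (hV : V ⊆ s.X j) (hSV : ∀ x ∈ S, x ∉ V)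
    (hg : g ∈ S) (hS : S ⊆ s.X j \ J)
    (hSself : ∀ l, s.M l = .white l → l ≠ j → ∀ z ∈ S, α * v l (S.erase z) ≤ v l (s.Z l))
    (hk : s.M k = .white k) (hkj : k ≠ j) (hkS : v k (s.Z k) < α * v k S)
    (h₂ : s₂.Inv α v (α * P))
    (hX₂ : ∀ l, s₂.X l = if l = j then V else s.X l)
    (hZ₂ : ∀ l, s₂.Z l = if l = j then V else s.Z l)
    (hM₂ : ∀ l, l ≠ i → s₂.M l = if s.M l = .white j then .unmatched else s.M l)
    (hMi : s₂.M i = .blue J ∨ s₂.M i = .white j ∧ V = J)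
    (hX : ∀ l, s'.X l = if l = k then s₂.Z l else s₂.X l) (hZ : ∀ l, s'.Z l = s₂.Z l)
    (hM : ∀ l, s'.M l = if l = k then .blue S else s₂.M l) :
    s'.Inv α v P ∧ Progress s s' := by
  have hij : i ≠ j := ht.ne hmono hα hJZ
  have hki : k ≠ i := fun hki => by simp [hki, ht.unmatched] at hk
  have hSR : ∀ x ∈ S, x ∈ s.X j ∧ x ∉ J := fun x hx => Finset.mem_sdiff.1 (hS hx)
  -- Robustness must be used in `s`: in `s₂` the set `X j` is already `V`, which is disjoint from
  -- `S`.
  have hSrob : ∀ l w, s.Robust α v l w → α * v l S ≤ w := fun l w hl => by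
    obtain ⟨z₀, hz₀⟩ := ht.nonempty
    have hSz : S ⊆ (s.X j).erase z₀ := fun x hx =>
      Finset.mem_erase.2 ⟨fun hxz => (hSR x hx).2 (hxz ▸ hz₀), (hSR x hx).1⟩
    exact (mul_le_mul_of_nonneg_left (hmono.2 _ _ _ hSz) ht.pos.le).trans
      (hl.large_le j z₀ (hJZ hz₀))
  have hself : ∀ l, s₂.M l = .white l → l ≠ j ∧ s.M l = .white l := by grind
  have hblue : ∀ l B, s₂.M l = .blue B → B = J ∨ s.M l = .blue B := by grind
  have hZX := h.layout.subset k
  refine ⟨h₂.move hmono hsub ht.pos hα hP (k := k) (S := S) ?_ ?_ ?_ ?_ ?_ ?_ hX hZ hM,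
    Progress.of_X (j := j) (fun l => ?_) (hSR g hg).1 ?_⟩
  · rw [hM₂ k hki, if_neg (by simpa [hk] using hkj), hk]
  · rwa [hZ₂, if_neg hkj]
  · intro l x hx
    rw [hX₂]
    split_ifs with hl
    · exact hSV x hx
    · exact fun hx' => hl (h.layout.disjoint l j x hx' (hSR x hx).1)
  · intro l B hB x hx
    obtain rfl | hB := hblue l B hB
    · exact (hSR x hx).2
    · exact fun hx' => h.layout.blue_disjoint l B hB j x hx' (hSR x hx).1
  · intro l hl z hz
    obtain ⟨hlj, hl⟩ := hself l hl
    rw [hZ₂, if_neg hlj]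
    exact hSself l hl hlj z hz
  · intro l B hl hB
    by_cases hli : l = i
    · obtain rfl : J = B := by unfold Holds at hB; grind
      exact hSrob l _ (hli ▸ ht.robust)
    · exact hSrob l _ (h.tolerant.robust l B (by unfold Holds at hB; grind)
        (by unfold Holds at *; grind))
  · rw [hX, hX₂, hZ₂]
    split_ifs with h1 h2 h2
    · exact h2 ▸ hV
    · exact h1 ▸ hZX
    · exact h2 ▸ hV
    · exact subset_rfl
  · rw [hX, if_neg hkj.symm, hX₂, if_pos rfl]
    exact hSV g hg

theorem Inv.split (h : s.Inv α v P) (ht : s.Taking α v i J) (hmono : IsMonotone v)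
    (hsub : IsSubadditive v) (hα : α ≤ 1 / 2) (hP : 0 ≤ P)
    (hg : g ∈ s.Z j) (hJ : J = (s.Z j).erase g)
    (hs : Split α v i j g J ((s.unmatchWhite j).matchTo i (.blue J)) s') :
    s'.Inv α v P ∧ Progress s s' := by
  have hα0 := ht.pos
  have hα1 : 0 < α + 1 := by linarith
  have hm : ∀ i S T, S ⊆ T → α * v i S ≤ α * v i T :=
    fun i S T hST => mul_le_mul_of_nonneg_left (hmono.2 i S T hST) hα0.le
  have hJZ : J ⊆ s.Z j := hJ ▸ Finset.erase_subset _ _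
  have hZX : s.Z j ⊆ s.X j := h.layout.subset j
  have hJX : J ⊆ s.X j := hJZ.trans hZX
  have hgJ : g ∉ J := by simp [hJ]
  have hij : i ≠ j := ht.ne hmono hα hJZ
  obtain ⟨z₀, hz₀⟩ := ht.nonempty
  have hi := ht.unmatched
  have hc0 : 0 ≤ α / (α + 1) := ratio_nonneg hα0.le
  have hc1 : α / (α + 1) ≤ 1 / (α + 1) := div_le_div_of_nonneg_right (by linarith) hα1.le
  have hXv : v j (s.X j) ≤ v j J + v j (s.X j \ J) := by
    simpa [Finset.union_sdiff_of_subset hJX] using hsub j J (s.X j \ J)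
  have hX0 := hmono.1 j (s.X j)
  set s₁ := (s.unmatchWhite j).matchTo i (.blue J) with hs₁
  have hX₁ : s₁.X = s.X := rfl
  have hZ₁ : s₁.Z = s.Z := rfl
  have hM₁ : ∀ l, s₁.M l = if l = i then .blue J else if s.M l = .white j then .unmatched
      else s.M l := fun l => by
    simp [hs₁, matchTo, unmatchWhite, Function.update_apply]
  have henv : ∀ S l, l ∈ s₁.envious α v S ↔
      s.M l = .white l ∧ l ≠ j ∧ v l (s.Z l) < α * v l S := by
    intro S l
    simp only [envious, Set.mem_ofPred_eq, hM₁, hZ₁]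
    grind
  -- Cases 1, 3 and 5 are a single `carve` with `d = α / (α + 1)`, paid for by the one new blue
  -- bundle `J`.
  have hcarve : ∀ (t : State n m) W, W ⊆ s.X j \ J →
      (α / (α + 1)) * v j (s.X j) ≤ v j W →
      (∀ l, s.M l = .white l → l ≠ j → ∀ z ∈ W, α * v l (W.erase z) ≤ v l (s.Z l)) →
      (∀ l, t.X l = if l = j then W else s.X l) → (∀ l, t.Z l = if l = j then W else s.Z l) →
      (∀ l, t.M l = s₁.M l) → t.Inv α v P ∧ Progress s t := by
    intro t W hW hWv hself hX hZ hM
    refine ⟨h.carve ht hmono hα hg hJ hW hc0 hc1 hP (mul_comm _ _).le hWv hself hX hZ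
      fun l => (hM l).trans (hM₁ l), Progress.of_X (fun l => ?_) (hJX hz₀) ?_⟩
    · rw [hX]
      split_ifs with hl
      · exact hl ▸ hW.trans Finset.sdiff_subset
      · exact subset_rfl
    · rw [hX, if_pos rfl]
      grind
  -- A violation would make `S` minus `z` a smaller envied subset.
  have hminself : ∀ S, s₁.IsMinEnvied α v (s.X j \ J) S →
      ∀ l, s.M l = .white l → l ≠ j → ∀ z ∈ S, α * v l (S.erase z) ≤ v l (s.Z l) := by
    intro S hS l hl hlj z hz
    by_contra! hlt
    have := hS.2.2 (S.erase z) ((Finset.erase_subset _ _).trans hS.1)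
      ⟨l, (henv _ _).2 ⟨hl, hlj, hlt⟩⟩
    exact absurd (Finset.card_erase_lt_of_mem hz) (by omega)
  -- Without `g`, the set `S` would be part of the red bundle at `j`, towards which `k` is safe.
  have hmem : ∀ S k, S ⊆ s.X j \ J → k ∈ s₁.envious α v S → g ∈ S := by
    intro S k hS hk
    obtain ⟨hk, -, hlt⟩ := (henv S k).1 hk
    by_contra hgS
    have h1 : S ⊆ s.X j \ s.Z j := by grind
    linarith [hm k _ _ h1, (h.tolerant.safe k hk).red_le j]
  cases hs with
  | case1 hgv =>
    refine hcarve _ {g} (by grind) hgv ?_ ?_ ?_ ?_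
    · intro l hl _ z hz
      exact (hm _ _ _ (by grind)).trans ((h.tolerant.safe l hl).red_le j)
    all_goals intro l; simp [shrink, change, Function.update_apply, hX₁, hZ₁]
  | case2 hgv hK hR =>
    have hR' : v j (s.X j \ J) * (α + 1) < α * v j (s.X j) := by
      rwa [hX₁, div_mul_eq_mul_div, lt_div_iff₀ hα1] at hR
    have hX : ∀ l, ((s₁.change j J).matchTo i (.white j)).X l = s.X l := fun l => rfl
    have hZ : ∀ l, ((s₁.change j J).matchTo i (.white j)).Z l = if l = j then J else s.Z l := by
      intro l; simp [change, matchTo, Function.update_apply, hZ₁]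
    -- No credit is lost: `hR'` and subadditivity give `v j (X j) ≤ (α + 1) * v j J`.
    refine ⟨h.pass ht hmono hα (W := s.X j) (d := 1) hJZ hJX subset_rfl zero_le_one le_rfl hP
      (one_mul P).ge (one_mul _).le (by nlinarith) ?_ (fun l => ?_) hZ (fun l => ?_),
      Progress.of_Z (j := j) hX (fun l => ?_) hg (by rwa [hZ, if_pos rfl])⟩
    · intro l hl hlj
      by_contra! hlt
      have := hK _ subset_rfl
      exact (this ▸ (henv _ l).2 ⟨hl, hlj, hlt⟩ : l ∈ (∅ : Set (Fin n)))
    · rw [hX]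
      split_ifs with hl
      · rw [hl]
      · rfl
    · simp only [change, matchTo, Function.update_apply, hM₁]
      grind
    · rw [hZ]
      split_ifs with hl
      · exact hl ▸ hJZ
      · exact subset_rfl
  | case3 hgv hK hR =>
    refine hcarve _ (s.X j \ J) subset_rfl hR ?_ ?_ ?_ ?_
    · intro l hl hlj z hz
      by_contra! hlt
      have := hK ((s.X j \ J).erase z) (Finset.erase_subset _ _)
      exact (this ▸ (henv _ l).2 ⟨hl, hlj, hlt⟩ : l ∈ (∅ : Set (Fin n)))
    all_goals intro l; simp [shrink, change, Function.update_apply, hX₁, hZ₁]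
  | case4 S k hgv hS hk hJv =>
    obtain ⟨hMk, hkj, hkS⟩ := (henv S k).1 hk
    have hgS := hmem S k hS.1 hk
    let s₂ : State n m :=
      { X := fun l => if l = j then J else s.X l
        Z := fun l => if l = j then J else s.Z l
        M := fun l => if l = i then .white j else if s.M l = .white j then .unmatched else s.M l }
    -- The iteration is cut in two: passing `J` costs a factor `α` and creates no blue bundle, and
    -- the move of `k` to `S` regains this `α`.
    have h₂ : s₂.Inv α v (α * P) := by
      refine h.pass ht hmono hα (W := J) (d := α) hJZ subset_rfl hJX hα0.le (by linarith)
        (by positivity) le_rfl hJv ?_ ?_ (fun l => rfl) (fun l => rfl) (fun l => rfl)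
      · exact hJv.trans (le_mul_of_one_le_left (hmono.1 _ _) (by linarith))
      · intro l hl _
        exact (hm _ _ _ (by simp)).trans ((h.tolerant.safe l hl).red_le j)
    refine h.splitMove ht hmono hsub hα hP (k := k) (V := J) hJZ hJX
      (fun x hx => (Finset.mem_sdiff.1 (hS.1 hx)).2) hgS hS.1
      (hminself S hS) hMk hkj hkS h₂ (fun l => rfl) (fun l => rfl) (fun l hl => if_neg hl)
      (.inr ⟨if_pos rfl, rfl⟩) (fun l => ?_) (fun l => ?_) (fun l => ?_)
    · simp only [change, matchTo, shrink, Function.update_apply, hX₁, hZ₁, s₂]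
      by_cases h1 : l = j
      · simp only [h1, if_true, hkj.symm, if_false]
      · by_cases h2 : l = k
        · simp only [h2, hkj, if_true, if_false]
        · simp only [h1, h2, if_false]
    · simp only [change, matchTo, shrink, Function.update_apply, hX₁, hZ₁, s₂]
    · simp only [change, matchTo, shrink, Function.update_apply, hM₁, s₂]
      split_ifs <;> rfl
  | case5 S k hgv hS hk hJv hSv =>
    refine hcarve _ S hS.1 hSv (hminself S hS) ?_ ?_ ?_
    all_goals intro l; simp [shrink, change, Function.update_apply, hX₁, hZ₁]
  | case6 S k hgv hS hk hJv hSv =>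
    obtain ⟨hMk, hkj, hkS⟩ := (henv S k).1 hk
    have hgS := hmem S k hS.1 hk
    let s₂ : State n m :=
      { X := fun l => if l = j then (s.X j \ J) \ S else s.X l
        Z := fun l => if l = j then (s.X j \ J) \ S else s.Z l
        M := fun l => if l = i then .blue J else if s.M l = .white j then .unmatched else s.M l }
    have hSv' : v j S * (α + 1) < α * v j (s.X j) := by
      rwa [hX₁, div_mul_eq_mul_div, lt_div_iff₀ hα1] at hSv
    have hRv : v j (s.X j \ J) ≤ v j S + v j ((s.X j \ J) \ S) := by
      have := hsub j S ((s.X j \ J) \ S)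
      rwa [Finset.union_sdiff_of_subset (show S ⊆ s.X j \ J from hS.1)] at this
    -- Again an extra `α` is lost here and regained by the move of `k`; the two steps together
    -- create two blue bundles.
    have h₂ : s₂.Inv α v (α * P) := by
      refine h.carve ht hmono hα (W := (s.X j \ J) \ S) (d := α * (α / (α + 1))) hg hJ
        Finset.sdiff_subset (by positivity) ?_ (by positivity) ?_ ?_ ?_
        (fun l => rfl) (fun l => rfl) (fun l => rfl)
      · exact (mul_le_of_le_one_left hc0 (by linarith)).trans hc1
      · exact le_of_eq (by ring)
      · have hJv' : v j J < α * v j (s.X j) := hJv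
        rw [← mul_div_assoc, div_mul_eq_mul_div, div_le_iff₀ hα1]
        -- Subadditivity over `J`, `S` and the rest leaves `1 - α - α / (α + 1)` of `v j (X j)`.
        -- This is at least `α ^ 2 / (α + 1)` because `1 - α - 2 * α ^ 2 = (1 - 2 * α) * (1 + α) ≥
        -- 0`.
        nlinarith [mul_nonneg (mul_nonneg hα0.le hX0) (sub_nonneg.2 hα)]
      · intro l hl _ z _
        exact (hm _ _ _ (by grind)).trans ((h.tolerant.safe l hl).red_le j)
    refine h.splitMove ht hmono hsub hα hP (k := k) (V := (s.X j \ J) \ S) hJZ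
      (Finset.sdiff_subset.trans Finset.sdiff_subset) (fun x hx => by simp [hx]) hgS hS.1
      (hminself S hS) hMk hkj hkS h₂ (fun l => rfl) (fun l => rfl) (fun l hl => if_neg hl)
      (.inl (if_pos rfl)) (fun l => ?_) (fun l => ?_) (fun l => ?_)
    · simp only [change, matchTo, shrink, Function.update_apply, hX₁, hZ₁, s₂]
      by_cases h1 : l = j
      · simp only [h1, if_true, hkj.symm, if_false]
      · by_cases h2 : l = k
        · simp only [h2, hkj, if_true, if_false]
        · simp only [h1, h2, if_false]
    · simp only [change, matchTo, shrink, Function.update_apply, hX₁, hZ₁, s₂]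
    · simp only [change, matchTo, shrink, Function.update_apply, hM₁, s₂]

theorem Inv.step (h : s.Inv α v P) (hmono : IsMonotone v) (hsub : IsSubadditive v) (hα0 : 0 ≤ α)
    (hα : α ≤ 1 / 2) (hP : 0 ≤ P) (hs : Step α v s s') : s'.Inv α v P ∧ Progress s s' := by
  cases hs with
  | self i hi hgood =>
    have hX : ∀ l, ((s.unmatchWhite i).matchTo i (.white i)).X l = s.X l := fun l => rfl
    have hZ : ∀ l, ((s.unmatchWhite i).matchTo i (.white i)).Z l = s.Z l := fun l => rfl
    have hM : ∀ l, ((s.unmatchWhite i).matchTo i (.white i)).M l =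
        if l = i then .white i else if s.M l = .white i then .unmatched else s.M l := fun l => by
      simp [matchTo, unmatchWhite, Function.update_apply]
    obtain ⟨y, hy⟩ := h.credit
    exact ⟨⟨h.layout.self hi hX hZ hM, h.tolerant.self (safe_iff.2 hgood) hX hZ hM,
      y, hy.self hα0 hi hP hX hZ hM⟩, Progress.of_self hi hX hZ hM⟩
  | white i J j g _ hi hJ hgood hg hJg hsplit =>
    exact h.split (taking_of_isFavorite hmono hsub hα0 hα hi hJ hgood) hmono hsub hα hP hg hJg
      hsplit
  | red i J j hi hJ hgood hwhite hJj =>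
    refine h.takeRed (j := j) (taking_of_isFavorite hmono hsub hα0 hα hi hJ hgood) hmono hα hP hJj
      (fun l => ?_) (fun l => rfl) (fun l => ?_)
    · by_cases hl : l = j
      · subst hl
        simp [matchTo, shrink]
      · simp [matchTo, shrink, hl]
    · simp [matchTo, shrink, Function.update_apply]
  | blue i J j B g hi hJ hgood hwhite hred hB hg hJg =>
    have ht := taking_of_isFavorite hmono hsub hα0 hα hi hJ hgood
    -- If `j` held a white bundle, `J` would be a white bundle minus an item, a case already
    -- excluded.
    have hBj : s.M j = .blue B := by
      obtain hBj | ⟨k, -, rfl⟩ := (s.bundle_eq_some_iff j B).1 hB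
      · exact hBj
      · exact (hwhite ⟨k, g, hg, hJg⟩).elim
    have hX : ∀ l, ((s.unmatchAgent j).matchTo i (.blue J)).X l = s.X l := fun l => rfl
    have hZ : ∀ l, ((s.unmatchAgent j).matchTo i (.blue J)).Z l = s.Z l := fun l => rfl
    have hM : ∀ l, ((s.unmatchAgent j).matchTo i (.blue J)).M l =
        if l = i then .blue J else if l = j then .unmatched else s.M l := fun l => by
      simp [matchTo, unmatchAgent, Function.update_apply]
    have hJB : J ⊆ B := hJg ▸ Finset.erase_subset _ _
    obtain ⟨y, hy⟩ := h.credit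
    exact ⟨⟨h.layout.steal hi hBj hJB hX hZ hM, h.tolerant.steal
      (fun i S T hST => mul_le_mul_of_nonneg_left (hmono.2 i S T hST) hα0) hBj hJB ht.robust
      hX hZ hM, y, hy.steal h.layout hα0 hi hBj hP ht.lift hX hZ hM⟩,
      Progress.of_blue hi hBj hg hJg hX hZ hM⟩

/-! ### Runs: initial state, iteration bound, never stuck -/

theorem inv_init (hmono : IsMonotone v) (hα0 : 0 ≤ α) (hX : IsAllocation X) :
    (State.init X).Inv α v (∏ i, v i (X i)) := by
  have hM : ∀ i B, ¬ (State.init X).Holds i B := by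
    intro i B h
    obtain h | ⟨j, h, -⟩ := h <;> cases h
  refine ⟨⟨?_, fun _ _ => id, ?_, ?_, ?_, fun j h => (h rfl).elim⟩,
    ⟨?_, fun i B _ hB => (hM i B hB).elim⟩, fun i => v i (X i), fun i => hmono.1 _ _,
    fun i => le_rfl, fun i => ?_, fun i B _ hB => (hM i B hB).elim,
    fun i B _ hB => (hM i B hB).elim, ?_, ?_⟩
  · intro i j x hi hj
    by_contra hij
    exact Finset.disjoint_left.1 (hX i j hij) hi hj
  · intro i B h; cases h
  · intro i i' B B' h; cases h
  · intro i i' j h; cases h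
  · intro i h; cases h
  · exact le_mul_of_one_le_left (hmono.1 _ _) (by linarith)
  · simp [blueCount, State.init]
  · intro i B h; cases h

theorem reaches_inv (hmono : IsMonotone v) (hsub : IsSubadditive v) (hα0 : 0 ≤ α)
    (hα : α ≤ 1 / 2) (hX : IsAllocation X) {T : ℕ} (h : Reaches α v X T s) :
    s.Inv α v (∏ i, v i (X i)) ∧ T + s.potential < (n + 1) * (m + 1) ^ 3 := by
  induction h with
  | zero =>
    have h := inv_init hmono hα0 hX
    exact ⟨h, by simpa using h.layout.potential_lt⟩
  | succ _ hs ih =>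
    obtain ⟨h, hp⟩ := ih.1.step hmono hsub hα0 hα (Finset.prod_nonneg fun i _ => hmono.1 _ _) hs
    exact ⟨h, by have := hp.potential_lt h.layout; omega⟩

theorem exists_split (α : ℝ) (v : Valuations n m) (i j : Fin n) (g : Fin m)
    (J : Finset (Fin m)) (s : State n m) : ∃ s', Split α v i j g J s s' := by
  by_cases hg : (α / (α + 1)) * v j (s.X j) ≤ v j {g}
  · exact ⟨_, .case1 hg⟩
  rw [not_le] at hg
  by_cases hK : ∀ S, S ⊆ s.X j \ J → s.envious α v S = ∅
  · by_cases hR : v j (s.X j \ J) < (α / (α + 1)) * v j (s.X j)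
    · exact ⟨_, .case2 hg hK hR⟩
    · exact ⟨_, .case3 hg hK (not_lt.1 hR)⟩
  push Not at hK
  obtain ⟨S, ⟨hSR, k, hk⟩, hmin⟩ := Set.exists_min_image
    {S | S ⊆ s.X j \ J ∧ (s.envious α v S).Nonempty} Finset.card (Set.toFinite _) hK
  have hS : s.IsMinEnvied α v (s.X j \ J) S := ⟨hSR, ⟨k, hk⟩, fun S' h1 h2 => hmin S' ⟨h1, h2⟩⟩
  by_cases hJ : α * v j (s.X j) ≤ v j J
  · exact ⟨_, .case4 S k hg hS hk hJ⟩
  rw [not_le] at hJ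
  by_cases hjS : (α / (α + 1)) * v j (s.X j) ≤ v j S
  · exact ⟨_, .case5 S k hg hS hk hJ hjS⟩
  · exact ⟨_, .case6 S k hg hS hk hJ (not_le.1 hjS)⟩

theorem exists_step (α : ℝ) (v : Valuations n m) (hs : ¬ s.IsFinal) : ∃ s', Step α v s s' := by
  unfold IsFinal at hs
  push Not at hs
  obtain ⟨i, hi⟩ := hs
  by_cases hgood : s.SelfGood α v i
  · exact ⟨_, .self i hi hgood⟩
  -- A favorite exists because red bundles, possibly empty, are always available.
  obtain ⟨J, hJA, hJ⟩ := Set.exists_max_image {J | s.Avail J} (v i) (Set.toFinite _)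
    ⟨_, .inr (.inl ⟨i, rfl⟩)⟩
  have hfav : s.IsFavorite v i J := ⟨hJA, hJ⟩
  by_cases hw : s.WhiteAvail J
  · obtain ⟨j, g, hg, hJg⟩ := hw
    obtain ⟨s', h⟩ := exists_split α v i j g J ((s.unmatchWhite j).matchTo i (.blue J))
    exact ⟨s', .white i J j g s' hi hfav hgood hg hJg h⟩
  by_cases hr : s.RedAvail J
  · obtain ⟨j, hJj⟩ := hr
    exact ⟨_, .red i J j hi hfav hgood hw hJj⟩
  obtain ⟨j, B, hB, g, hg, hJg⟩ := (hJA.resolve_left hw).resolve_left hr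
  exact ⟨_, .blue i J j B g hi hfav hgood hw hr hB hg hJg⟩

/-! ### The output -/

theorem IsFinal.holds_output (h : s.IsFinal) (i : Fin n) : s.Holds i (s.output i) := by
  have hi := h i
  unfold Holds output bundle
  cases hM : s.M i with
  | unmatched => exact (hi hM).elim
  | white j => exact .inr ⟨j, rfl, rfl⟩
  | blue B => exact .inl rfl

theorem Layout.isAllocation_output (h : s.Layout) (hf : s.IsFinal) : IsAllocation s.output := by
  intro i j hij
  refine Finset.disjoint_left.2 fun x hi hj => ?_
  obtain h1 | ⟨k, h1, hk⟩ := hf.holds_output i <;> obtain h2 | ⟨l, h2, hl⟩ := hf.holds_output j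
  · exact hij (h.blue_blue i j _ _ h1 h2 x hi hj)
  · rw [← hl] at hj
    exact h.blue_disjoint i _ h1 l x hi (h.subset l x hj)
  · rw [← hk] at hi
    exact h.blue_disjoint j _ h2 k x hj (h.subset k x hi)
  · rw [← hk] at hi
    rw [← hl] at hj
    obtain rfl := h.disjoint k l x (h.subset k x hi) (h.subset l x hj)
    exact hij (h.white_inj i j k h1 h2)

theorem Tolerant.safe_of_holds (h : s.Tolerant α v) {i : Fin n} {B : Finset (Fin m)}
    (hB : s.Holds i B) : s.Safe α v i (v i B) := by
  by_cases hi : s.M i = .white i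
  · obtain rfl : s.Z i = B := by unfold Holds at hB; grind
    exact h.safe i hi
  · exact (h.robust i B hi hB).toSafe

theorem Tolerant.isEFX_output (h : s.Tolerant α v) (hf : s.IsFinal) : IsEFX α v s.output := by
  intro i j g hg
  have hs := h.safe_of_holds (hf.holds_output i)
  obtain h1 | ⟨k, h1, hk⟩ := hf.holds_output j
  · exact hs.blue_le j _ h1 g hg
  · rw [← hk] at hg ⊢
    exact hs.white_le k g hg

/-- There are as many white bundles as agents, and sending each matched white bundle to a holder is
injective into the agents without a blue bundle. -/
theorem blueCount_le_card_free (s : State n m) :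
    s.blueCount ≤ (Finset.univ.filter fun j => ∀ u, s.M u ≠ .white j).card := by
  have h1 := Finset.card_filter_add_card_filter_not (s := (Finset.univ : Finset (Fin n)))
    (fun i => ∃ B, s.M i = .blue B)
  have h2 := Finset.card_filter_add_card_filter_not (s := (Finset.univ : Finset (Fin n)))
    (fun j => ∀ u, s.M u ≠ .white j)
  have h3 : (Finset.univ.filter fun j => ¬ ∀ u, s.M u ≠ .white j).card ≤
      (Finset.univ.filter fun i => ¬ ∃ B, s.M i = .blue B).card := by
    have hex : ∀ j, ∃ u, (¬ ∀ u, s.M u ≠ .white j) → s.M u = .white j := fun j => by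
      by_cases h : ∀ u, s.M u ≠ .white j
      · exact ⟨j, fun h' => (h' h).elim⟩
      · obtain ⟨u, hu⟩ := not_forall.1 h
        exact ⟨u, fun _ => not_not.1 hu⟩
    choose f hf using hex
    refine Finset.card_le_card_of_injOn f (fun j hj => ?_) fun j hj k hk hjk => ?_
    · have := hf j (by simpa using hj)
      simp [this]
    · have h1 := hf j (by simpa using hj)
      have h2 := hf k (by simpa using hk)
      rw [hjk, h2] at h1
      exact (Partner.white.inj h1).symm
  unfold blueCount
  omega

theorem Credit.le_prod_output {y : Fin n → ℝ} (h : s.Credit α v P y) (hmono : IsMonotone v)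
    (hα0 : 0 ≤ α) (hα : α ≤ 1 / 2) (hf : s.IsFinal) :
    P ≤ (α + 1) ^ n * ∏ i, v i (s.output i) := by
  have hα1 : 0 < α + 1 := by linarith
  set V := ∏ i, v i (s.output i)
  have hV : 0 ≤ V := Finset.prod_nonneg fun i _ => hmono.1 _ _
  set b := s.blueCount with hb
  set U := Finset.univ.filter fun j => ∀ u, s.M u ≠ .white j with hU
  have hbU : b ≤ U.card := blueCount_le_card_free s
  have hUn : U.card ≤ n := (Finset.card_le_univ _).trans_eq (Fintype.card_fin n)
  have hb0 : 0 < α ^ b := by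
    rcases Nat.eq_zero_or_pos b with h0 | h0
    · simp [h0]
    · obtain ⟨i, hi⟩ := Finset.card_pos.1 h0
      simp only [Finset.mem_filter, Finset.mem_univ, true_and] at hi
      exact pow_pos (h.pos i _ hi.choose_spec) b
  have hy : ∏ j, y j ≤ ∏ j, (if j ∈ U then α else α + 1) * v j (s.output j) := by
    refine Finset.prod_le_prod (fun j _ => h.nonneg j) fun j _ => ?_
    have hj := hf.holds_output j
    by_cases hjM : s.M j = .white j
    · have hjU : j ∉ U := by simp only [hU, Finset.mem_filter]; exact fun h => h.2 j hjM
      rw [if_neg hjU]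
      obtain hZ : s.Z j = s.output j := by unfold Holds at hj; grind
      exact hZ ▸ h.le_Z j
    · split_ifs with hjU
      · exact h.le_free j _ hjM hj (Finset.mem_filter.1 hjU).2
      · exact (h.le_other j _ hjM hj).trans (mul_le_mul_of_nonneg_left
          (mul_value_le hmono hα _ _) hα1.le)
  have hprod : ∏ j, (if j ∈ U then α else α + 1) * v j (s.output j) =
      α ^ U.card * (α + 1) ^ (n - U.card) * V := by
    have h1 : Finset.univ.filter (· ∈ U) = U := by ext; simp
    have h2 : Finset.univ.filter (· ∉ U) = Uᶜ := by ext; simp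
    rw [Finset.prod_mul_distrib, Finset.prod_ite, Finset.prod_const, Finset.prod_const, h1, h2,
      Finset.card_compl, Fintype.card_fin]
  -- Free white bundles beyond the first `b` have their factor `α` raised to `α + 1`.
  have hpow : α ^ U.card * (α + 1) ^ (n - U.card) ≤ α ^ b * (α + 1) ^ (n - b) := by
    obtain ⟨e, he⟩ := Nat.exists_eq_add_of_le hbU
    obtain ⟨r, hr⟩ := Nat.exists_eq_add_of_le hUn
    have h1 : n - U.card = r := by omega
    have h2 : n - b = e + r := by omega
    rw [h1, h2, he, pow_add, pow_add, mul_assoc]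
    have : α ^ e ≤ (α + 1) ^ e := pow_le_pow_left₀ hα0 (by linarith) e
    gcongr
  have hmain : P * (α / (α + 1)) ^ b ≤ α ^ b * (α + 1) ^ (n - b) * V :=
    ((h.prod_le.trans hy).trans_eq hprod).trans (mul_le_mul_of_nonneg_right hpow hV)
  rw [div_pow, ← mul_div_assoc, div_le_iff₀ (pow_pos hα1 b)] at hmain
  have hn : (α + 1) ^ n = (α + 1) ^ (n - b) * (α + 1) ^ b := by
    rw [← pow_add, Nat.sub_add_cancel (hbU.trans hUn)]
  refine le_of_mul_le_mul_right (hmain.trans_eq ?_) hb0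
  rw [hn]
  ring

end State

/-! ### From products of values to Nash welfare, and conclusion -/

theorem nashWelfare_eq_rpow {v : Valuations n m} (hmono : IsMonotone v) (X : Bundles n m) :
    nashWelfare v X = (∏ i, v i (X i)) ^ (1 / (n : ℝ)) :=
  Real.finsetProd_rpow _ _ (fun _ _ => hmono.1 _ _) _

theorem nashWelfare_div_le {α : ℝ} {v : Valuations n m} (hmono : IsMonotone v) (hα0 : 0 ≤ α)
    {X Y : Bundles n m} (h : ∏ i, v i (X i) ≤ (α + 1) ^ n * ∏ i, v i (Y i)) :
    nashWelfare v X / (α + 1) ≤ nashWelfare v Y := by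
  have hα1 : 0 < α + 1 := by linarith
  -- Without agents no `n`-th root can be taken; both welfares are the empty product 1.
  rcases Nat.eq_zero_or_pos n with rfl | hn
  · simp only [nashWelfare, Finset.univ_eq_empty, Finset.prod_empty]
    rw [div_le_one hα1]
    linarith
  · rw [nashWelfare_eq_rpow hmono, nashWelfare_eq_rpow hmono, div_le_iff₀ hα1]
    have hX : 0 ≤ ∏ i, v i (X i) := Finset.prod_nonneg fun i _ => hmono.1 _ _
    have hY : 0 ≤ ∏ i, v i (Y i) := Finset.prod_nonneg fun i _ => hmono.1 _ _
    refine (Real.rpow_le_rpow hX h (by positivity)).trans_eq ?_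
    rw [Real.mul_rpow (by positivity) hY, one_div, Real.pow_rpow_inv_natCast hα1.le hn.ne',
      mul_comm]

/-- If no run returned, every run could be extended, giving runs longer than the iteration bound. -/
theorem exists_returns {α : ℝ} {v : Valuations n m} (hmono : IsMonotone v)
    (hsub : IsSubadditive v) (hα0 : 0 ≤ α) (hα : α ≤ 1 / 2) {X : Bundles n m}
    (hX : IsAllocation X) : ∃ M, Returns α v X M := by
  by_contra! h
  have key : ∀ T, ∃ s, Reaches α v X T s := by
    intro T
    induction T with
    | zero => exact ⟨_, .zero⟩
    | succ T ih =>
      obtain ⟨s, hs⟩ := ih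
      obtain ⟨s', hs'⟩ := State.exists_step α v fun hf => h _ ⟨T, s, hs, hf, rfl⟩
      exact ⟨s', .succ hs hs'⟩
  obtain ⟨s, hs⟩ := key ((n + 1) * (m + 1) ^ 3)
  have := (State.reaches_inv hmono hsub hα0 hα hX hs).2
  omega

theorem Returns.guarantees {α : ℝ} {v : Valuations n m} (hmono : IsMonotone v)
    (hsub : IsSubadditive v) (hα0 : 0 ≤ α) (hα : α ≤ 1 / 2) {X M : Bundles n m}
    (hX : IsAllocation X) (h : Returns α v X M) :
    IsAllocation M ∧ IsEFX α v M ∧ nashWelfare v X / (α + 1) ≤ nashWelfare v M := by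
  obtain ⟨T, s, hs, hf, rfl⟩ := h
  have hinv := (State.reaches_inv hmono hsub hα0 hα hX hs).1
  obtain ⟨y, hy⟩ := hinv.credit
  exact ⟨hinv.layout.isAllocation_output hf, hinv.tolerant.isEFX_output hf,
    nashWelfare_div_le hmono hα0 (hy.le_prod_output hmono hα0 hα hf)⟩

/-- There are finitely many allocations, so one of maximum Nash welfare exists and can serve as
input. -/
theorem exists_isEFX_isMNW {α : ℝ} {v : Valuations n m} (hmono : IsMonotone v)
    (hsub : IsSubadditive v) (hα0 : 0 ≤ α) (hα : α ≤ 1 / 2) :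
    ∃ M, IsAllocation M ∧ IsEFX α v M ∧ IsMNW (1 / (α + 1)) v M := by
  obtain ⟨X, hX, hmax⟩ := Set.exists_max_image {X : Bundles n m | IsAllocation X} (nashWelfare v)
    (Set.toFinite _) ⟨fun _ => ∅, fun _ _ _ => Finset.disjoint_empty_left _⟩
  obtain ⟨M, hM⟩ := exists_returns hmono hsub hα0 hα hX
  obtain ⟨h1, h2, h3⟩ := hM.guarantees hmono hsub hα0 hα hX
  refine ⟨M, h1, h2, fun Y hY => le_trans ?_ h3⟩
  rw [one_div_mul_eq_div]
  exact div_le_div_of_nonneg_right (hmax Y hY) (by linarith)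

end FairDivision

theorem mainTheorem5 (n m : ℕ) (v : FairDivision.Valuations n m)
    (hmono : FairDivision.IsMonotone v) (hsub : FairDivision.IsSubadditive v)
    (α : ℝ) (hα0 : 0 ≤ α) (hα : α ≤ 1 / 2) :
    -- existence of the partial allocation
    (∃ M : FairDivision.Bundles n m, FairDivision.IsAllocation M ∧
      FairDivision.IsEFX α v M ∧ FairDivision.IsMNW (1 / (α + 1)) v M) ∧
    -- the algorithm, on an arbitrary complete allocation
    ∀ X : FairDivision.Bundles n m, FairDivision.IsAllocation X → FairDivision.IsComplete X →
      -- every run makes polynomially many iterations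
      (∀ T s, FairDivision.Reaches α v X T s → T ≤ (n + 1) * (m + 1) ^ 3) ∧
      -- no run gets stuck before all agents are matched
      (∀ T s, FairDivision.Reaches α v X T s → ¬ s.IsFinal →
        ∃ s', FairDivision.Step α v s s') ∧
      -- so some `M` is returned, and every `M` that can be returned has the stated guarantees
      (∃ M, FairDivision.Returns α v X M) ∧
      ∀ M, FairDivision.Returns α v X M →
        FairDivision.IsAllocation M ∧ FairDivision.IsEFX α v M ∧
          FairDivision.nashWelfare v X / (α + 1) ≤ FairDivision.nashWelfare v M := by
  refine ⟨FairDivision.exists_isEFX_isMNW hmono hsub hα0 hα, fun X hX _ =>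
    ⟨fun T s hs => ?_, fun T s _ hs => FairDivision.State.exists_step α v hs,
      FairDivision.exists_returns hmono hsub hα0 hα hX,
      fun M hM => hM.guarantees hmono hsub hα0 hα hX⟩⟩
  have := (FairDivision.State.reaches_inv hmono hsub hα0 hα hX hs).2
  omega
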